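/- Let $\mathcal T$ be a finite simplicial complex, i.e. a finite set of finite non-empty sets (simplexes) such that every non-empty subset of a simplex $T\in\mathcal T$ belongs to $\mathcal T$. A simplex with $k+1$ elements is called a $k$-simplex; for each $k$-simplex $T$ fix a bijection $\sigma_T:\{0,\dots,k\}\to T$. Let each $T\in\mathcal T$ be equipped with an affine realization, i.e. an injection $\rho_T:T\to V_T$ into a real affine space whose image is affinely independent; let $|T|$ be the convex hull of $\rho_T(T)$ and, for $T'\subset T$ in $\mathcal T$, let $i_{TT'}:|T'|\to|T|$ be the affine map sending $\rho_{T'}(v)$ to $\rho_T(v)$ for every $v\in T'$. Let $\Omega^k(\mathcal T)$ be the real vector space of families $(u_T)_{T\in\mathcal T}$, where $u_T$ is a $k$-form on $|T|$ having a smooth extension to the affine span of $|T|$, such that $i_{TT'}^\star u_T=u_{T'}$ whenever $T'\subset T$. The exterior derivative, taken on each simplex, gives maps $\mathrm d:\Omega^k(\mathcal T)\to\Omega^{k+1}(\mathcal T)$ with $\mathrm d\circ\mathrm d=0$. For each vertex $v$ let $\lambda_v\in\Omega^0(\mathcal T)$ be the function which on $|T|$ is the barycentric coordinate relative to $v$ if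 $v\in T$, and $0$ if $v\notin T$. For a $k$-simplex $T$ put $$\lambda_T=k!\sum_{i=0}^k(-1)^i\,\lambda_{\sigma_T(i)}\,\mathrm d\lambda_{\sigma_T(0)}\wedge\cdots\wedge\widehat{\mathrm d\lambda_{\sigma_T(i)}}\wedge\cdots\wedge\mathrm d\lambda_{\sigma_T(k)}\in\Omega^k(\mathcal T),$$ where the hat denotes omission (for $k=0$, $\lambda_T=\lambda_{\sigma_T(0)}$), and let $\Lambda^k(\mathcal T)\subset\Omega^k(\mathcal T)$ be the linear span of the $\lambda_T$ over all $k$-simplexes $T\in\mathcal T$ (the lowest order, or Whitney, finite elements). One has $\mathrm d\Lambda^k(\mathcal T)\subset\Lambda^{k+1}(\mathcal T)$, so $\Lambda^\bullet(\mathcal T)$ is a subcomplex of $\Omega^\bullet(\mathcal T)$. **Theorem.** For every $k\ge 0$, the inclusion $\Lambda^\bullet(\mathcal T)\to\Omega^\bullet(\mathcal T)$ induces an isomorphism in cohomology $$\mathrm H^k\Lambda^\bullet(\mathcal T)\;\longrightarrow\;\mathrm H^k\Omega^\bullet(\mathcal T).$$ -/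

import Mathlib

noncomputable section

namespace PiecewiseForms

open scoped ContDiff

/-! ### Differential forms on a subset of an affine space -/

section Forms

variable {E A : Type*} [NormedAddCommGroup E] [NormedSpace ℝ E] [AddTorsor E A] {B : Set A} {k : ℕ}

/-- A `k`-form on the affine space `A` is smooth. -/
def IsSmooth (f : A → E [⋀^Fin k]→L[ℝ] ℝ) : Prop :=
  ∀ p : A, ContDiff ℝ ∞ fun v : E => f (v +ᵥ p)

/-- A `k`-form on the subset `B` of the affine space `A` is smooth if it is the restriction of a
smooth `k`-form on `A`. -/
def IsSmoothOn (u : B → E [⋀^Fin k]→L[ℝ] ℝ) : Prop :=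
  ∃ f : A → E [⋀^Fin k]→L[ℝ] ℝ, IsSmooth f ∧ ∀ x : B, f x = u x

/-- The exterior derivative of a form on `B`. At `x ∈ B`, the space `A` is identified with `E` by
`v ↦ v +ᵥ x`, and the exterior derivative within the set corresponding to `B` is taken. (The value
`0` given to the form outside `B` is irrelevant.) -/
def extD (u : B → E [⋀^Fin k]→L[ℝ] ℝ) (x : B) : E [⋀^Fin (k + 1)]→L[ℝ] ℝ :=
  extDerivWithin (fun v : E => Function.extend Subtype.val u 0 (v +ᵥ (x : A)))
    {v : E | v +ᵥ (x : A) ∈ B} 0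

/-- `B` has, at each of its points, enough tangent directions for derivatives within `B` to be
unique. -/
def UniqueDiff (B : Set A) : Prop :=
  ∀ x ∈ B, UniqueDiffWithinAt ℝ {v : E | v +ᵥ x ∈ B} 0

theorem extend_eq {X Y : Type*} [Zero Y] {B : Set X} (u : B → Y) {y : X} (hy : y ∈ B) :
    Function.extend Subtype.val u 0 y = u ⟨y, hy⟩ :=
  Subtype.val_injective.extend_apply u 0 ⟨y, hy⟩

theorem extD_eq (hB : UniqueDiff (E := E) B) {u : B → E [⋀^Fin k]→L[ℝ] ℝ}
    {f : A → E [⋀^Fin k]→L[ℝ] ℝ} (hf : IsSmooth f) (hu : ∀ x : B, f x = u x) (x : B) :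
    extD u x = extDeriv (fun v : E => f (v +ᵥ (x : A))) 0 := by
  have h0 : (0 : E) ∈ {v : E | v +ᵥ (x : A) ∈ B} := by simp
  have h1 : extD u x
      = extDerivWithin (fun v : E => f (v +ᵥ (x : A))) {v : E | v +ᵥ (x : A) ∈ B} 0 := by
    refine extDerivWithin_congr' (fun v hv => ?_) h0
    have hv' : v +ᵥ (x : A) ∈ B := hv
    simp only [extend_eq u hv']
    exact (hu ⟨_, hv'⟩).symm
  rw [h1, extDerivWithin, extDeriv, fderivWithin_eq_fderiv (hB x x.2)]
  exact ((hf x).differentiable (by simp)) 0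

/-- Exterior derivative of a form on `A`. -/
def extDA (f : A → E [⋀^Fin k]→L[ℝ] ℝ) (p : A) : E [⋀^Fin (k + 1)]→L[ℝ] ℝ :=
  extDeriv (fun v : E => f (v +ᵥ p)) 0

theorem extDA_vadd (f : A → E [⋀^Fin k]→L[ℝ] ℝ) (p : A) :
    (fun v : E => extDA f (v +ᵥ p)) = extDeriv (fun v : E => f (v +ᵥ p)) := by
  funext v
  simp only [extDA, extDeriv, ← add_vadd]
  congr 1
  have := fderiv_comp_add_right (𝕜 := ℝ) (f := fun w : E => f (w +ᵥ p)) (x := 0) v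
  simpa using this

theorem IsSmooth.extDA {f : A → E [⋀^Fin k]→L[ℝ] ℝ} (hf : IsSmooth f) : IsSmooth (extDA f) := by
  intro p
  rw [extDA_vadd]
  exact (ContinuousAlternatingMap.alternatizeUncurryFinCLM ℝ E ℝ (n := k)).contDiff.comp
    ((hf p).fderiv_right (m := ∞) (by simp))

theorem IsSmoothOn.extD (hB : UniqueDiff (E := E) B) {u : B → E [⋀^Fin k]→L[ℝ] ℝ}
    (hu : IsSmoothOn u) : IsSmoothOn (extD u) := by
  obtain ⟨f, hf, hfu⟩ := hu
  exact ⟨_, hf.extDA, fun x => (extD_eq hB hf hfu x).symm⟩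

theorem extD_extD (hB : UniqueDiff (E := E) B) {u : B → E [⋀^Fin k]→L[ℝ] ℝ}
    (hu : IsSmoothOn u) : extD (extD u) = 0 := by
  obtain ⟨f, hf, hfu⟩ := hu
  funext x
  rw [extD_eq hB hf.extDA (fun x => (extD_eq hB hf hfu x).symm), extDA_vadd]
  exact extDeriv_extDeriv_apply (hf x).contDiffAt (r := ∞)
    (by simpa using WithTop.coe_le_coe.2 (le_top : (2 : ℕ∞) ≤ ⊤))

theorem IsSmooth.add {f g : A → E [⋀^Fin k]→L[ℝ] ℝ} (hf : IsSmooth f) (hg : IsSmooth g) :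
    IsSmooth (f + g) := fun p => (hf p).add (hg p)

theorem IsSmooth.smul {f : A → E [⋀^Fin k]→L[ℝ] ℝ} (c : ℝ) (hf : IsSmooth f) :
    IsSmooth (c • f) := fun p => (hf p).const_smul c

theorem IsSmoothOn.zero : IsSmoothOn (0 : B → E [⋀^Fin k]→L[ℝ] ℝ) :=
  ⟨0, fun _ => contDiff_const, fun _ => rfl⟩

theorem IsSmoothOn.add {u v : B → E [⋀^Fin k]→L[ℝ] ℝ} (hu : IsSmoothOn u) (hv : IsSmoothOn v) :
    IsSmoothOn (u + v) := by
  obtain ⟨f, hf, hfu⟩ := hu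
  obtain ⟨g, hg, hgv⟩ := hv
  exact ⟨f + g, hf.add hg, fun x => by simp [hfu, hgv]⟩

theorem IsSmoothOn.smul {u : B → E [⋀^Fin k]→L[ℝ] ℝ} (c : ℝ) (hu : IsSmoothOn u) :
    IsSmoothOn (c • u) := by
  obtain ⟨f, hf, hfu⟩ := hu
  exact ⟨c • f, hf.smul c, fun x => by simp [hfu]⟩

theorem extD_add (hB : UniqueDiff (E := E) B) {u v : B → E [⋀^Fin k]→L[ℝ] ℝ}
    (hu : IsSmoothOn u) (hv : IsSmoothOn v) : extD (u + v) = extD u + extD v := by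
  obtain ⟨f, hf, hfu⟩ := hu
  obtain ⟨g, hg, hgv⟩ := hv
  funext x
  rw [Pi.add_apply, extD_eq hB hf hfu, extD_eq hB hg hgv,
    extD_eq hB (hf.add hg) (fun x => by simp [hfu, hgv])]
  exact extDeriv_add (((hf x).differentiable (by simp)) 0) (((hg x).differentiable (by simp)) 0)

theorem extD_smul (hB : UniqueDiff (E := E) B) (c : ℝ) {u : B → E [⋀^Fin k]→L[ℝ] ℝ}
    (hu : IsSmoothOn u) : extD (c • u) = c • extD u := by
  obtain ⟨f, hf, hfu⟩ := hu
  funext x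
  rw [Pi.smul_apply, extD_eq hB hf hfu, extD_eq hB (hf.smul c) (fun x => by simp [hfu])]
  exact extDeriv_smul c _

variable {E' A' : Type*} [NormedAddCommGroup E'] [NormedSpace ℝ E'] [FiniteDimensional ℝ E']
  [AddTorsor E' A'] {B' : Set A'}

/-- The differential of an affine map (its linear part). -/
def affineDeriv (g : A' →ᵃ[ℝ] A) : E' →L[ℝ] E := LinearMap.toContinuousLinearMap g.linear

/-- The pull-back of a form on `B` by an affine map which maps `B'` into `B`. -/
def pullback (g : A' →ᵃ[ℝ] A) (hg : Set.MapsTo g B' B) (u : B → E [⋀^Fin k]→L[ℝ] ℝ) (x : B') :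
    E' [⋀^Fin k]→L[ℝ] ℝ :=
  (u ⟨g x, hg x.2⟩).compContinuousLinearMap (affineDeriv g)

theorem extD_pullback (hB : UniqueDiff (E := E) B) (hB' : UniqueDiff (E := E') B')
    (g : A' →ᵃ[ℝ] A) (hg : Set.MapsTo g B' B) {u : B → E [⋀^Fin k]→L[ℝ] ℝ} (hu : IsSmoothOn u) :
    extD (pullback g hg u) = pullback g hg (extD u) := by
  obtain ⟨f, hf, hfu⟩ := hu
  have key : ∀ (p : A'), (fun v : E' => (f (g (v +ᵥ p))).compContinuousLinearMap (affineDeriv g))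
      = fun v : E' => ((fun w : E => f (w +ᵥ g p)) (affineDeriv g v)).compContinuousLinearMap
          (fderiv ℝ (affineDeriv g) v) := by
    intro p
    funext v
    rw [ContinuousLinearMap.fderiv]
    simp [affineDeriv]
  have hs : IsSmooth (fun p : A' => (f (g p)).compContinuousLinearMap (affineDeriv g)) := by
    intro p
    have h1 : ContDiff ℝ ∞ (fun v : E' => f (affineDeriv g v +ᵥ g p)) :=
      (hf (g p)).comp (affineDeriv g).contDiff
    have h2 := (ContinuousAlternatingMap.compContinuousLinearMapCLM (ι := Fin k) (F := ℝ)
      (affineDeriv g)).contDiff.comp h1 (n := ∞)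
    simpa [Function.comp_def, affineDeriv] using h2
  funext x
  rw [extD_eq hB' hs (fun x => by simp [pullback, ← hfu])]
  have hd : DifferentiableAt ℝ (fun w : E => f (w +ᵥ g x)) (affineDeriv g 0) :=
    ((hf (g x)).differentiable (by simp)) _
  rw [key x, extDeriv_pullback (r := ∞) hd (affineDeriv g).contDiff.contDiffAt
    (by simpa using WithTop.coe_le_coe.2 (le_top : (2 : ℕ∞) ≤ ⊤)), pullback,
    extD_eq hB hf hfu, ContinuousLinearMap.fderiv, map_zero]

/-- The wedge product `ℓ 0 ∧ ⋯ ∧ ℓ (k-1)` of continuous linear forms, that is the alternating form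
`v ↦ ∑ τ, sign τ * ∏ i, ℓ i (v (τ i))`. -/
def wedge (l : Fin k → E →L[ℝ] ℝ) : E [⋀^Fin k]→L[ℝ] ℝ :=
  ContinuousMultilinearMap.alternatization
    ((ContinuousMultilinearMap.mkPiAlgebra ℝ (Fin k) ℝ).compContinuousLinearMap l)

theorem wedge_apply (l : Fin k → E →L[ℝ] ℝ) (v : Fin k → E) :
    wedge l v = (Matrix.of fun i j => l i (v j)).det := by
  rw [← Matrix.det_transpose, Matrix.det_apply, wedge,
    ContinuousMultilinearMap.alternatization_apply_apply]
  simp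

end Forms

/-! ### Simplicial complexes with an affine realization -/

section Realization

variable {ι : Type*} {K : PreAbstractSimplicialComplex ι} {V : K.faces → Type*}
  [∀ s, NormedAddCommGroup (V s)] [∀ s, NormedSpace ℝ (V s)]

/-- An affine realization of a simplicial complex: each simplex `s` has its own injection of its
vertices into an affine space `V s`, such that the image is affinely independent, i.e. spans an
affine space of dimension the dimension of `s`. No relation is required between the realizations of
different simplexes. -/
structure AffineRealization (K : PreAbstractSimplicialComplex ι) (V : K.faces → Type*)
    [∀ s, NormedAddCommGroup (V s)] [∀ s, NormedSpace ℝ (V s)] where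
  vertex : ∀ s : K.faces, s.1 → V s
  indep : ∀ s, AffineIndependent ℝ (vertex s)

/-- An orientation of each simplex, in the form of an enumeration of its vertices. -/
abbrev Orientation (K : PreAbstractSimplicialComplex ι) : Type _ :=
  ∀ s : K.faces, Fin s.1.card ≃ s.1

namespace AffineRealization

variable (ρ : AffineRealization K V)

/-- The affine space generated by the realization of `s`. -/
abbrev plane (s : K.faces) : AffineSubspace ℝ (V s) := affineSpan ℝ (Set.range (ρ.vertex s))

/-- The space of tangent vectors to the realization of `s`. -/
abbrev tangent (s : K.faces) : Submodule ℝ (V s) := (ρ.plane s).direction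

instance (s : K.faces) : Nonempty s.1 := (K.isRelLowerSet_faces s.2).1.to_subtype

/-- The realization `|s|` of the simplex `s`: the convex hull of the realization of its vertices,
as a subset of the affine space it generates. -/
def body (s : K.faces) : Set (ρ.plane s) :=
  {x | (x : V s) ∈ convexHull ℝ (Set.range (ρ.vertex s))}

/-- The vertices of `|s|` as an affine basis of the affine space they generate. -/
def basis (s : K.faces) : AffineBasis s.1 ℝ (ρ.plane s) where
  toFun i := ⟨ρ.vertex s i, subset_affineSpan ℝ _ (Set.mem_range_self i)⟩
  ind' := AffineIndependent.of_comp (ρ.plane s).subtype (ρ.indep s)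
  tot' := by
    have h := affineSpan_coe_preimage_eq_top (k := ℝ) (Set.range (ρ.vertex s))
    convert h using 2
    ext x
    simp [Subtype.ext_iff]

theorem coe_basis (s : K.faces) (i : s.1) : (ρ.basis s i : V s) = ρ.vertex s i := rfl

/-- The canonical injection, for `t ⊆ s`: the affine map which sends each vertex of `t` in its
realization in `|t|` to its realization in `|s|`. -/
def face {t s : K.faces} (h : t.1 ⊆ s.1) : ρ.plane t →ᵃ[ℝ] ρ.plane s :=
  (Finset.univ.affineCombination ℝ fun i : t.1 => ρ.basis s ⟨i, h i.2⟩).comp (ρ.basis t).coords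

theorem face_vertex {t s : K.faces} (h : t.1 ⊆ s.1) (i : t.1) :
    ρ.face h (ρ.basis t i) = ρ.basis s ⟨i, h i.2⟩ := by
  classical
  rw [face, AffineMap.comp_apply]
  refine Finset.univ.affineCombination_of_eq_one_of_eq_zero _ _ (Finset.mem_univ i) ?_ ?_
  · simp
  · intro j _ hj
    simp [hj]

theorem face_mapsTo {t s : K.faces} (h : t.1 ⊆ s.1) :
    Set.MapsTo (ρ.face h) (ρ.body t) (ρ.body s) := by
  intro x hx
  have hx' : (x : V t) ∈ convexHull ℝ (Set.range (ρ.vertex t)) := hx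
  rw [convexHull_range_eq_exists_affineCombination] at hx'
  obtain ⟨f, w, hw0, hw1, hwx⟩ := hx'
  have e1 : x = f.affineCombination ℝ (ρ.basis t) w := by
    apply Subtype.ext
    rw [← hwx]
    exact (Finset.map_affineCombination f (ρ.basis t) w hw1 (ρ.plane t).subtype).symm
  have e2 : (ρ.face h x : V s)
      = f.affineCombination ℝ (fun i : t.1 => ρ.vertex s ⟨i, h i.2⟩) w := by
    rw [e1, Finset.map_affineCombination f (ρ.basis t) w hw1 (ρ.face h)]
    refine (Finset.map_affineCombination f _ w hw1 (ρ.plane s).subtype).trans ?_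
    congr 2
    funext i
    simp [face_vertex, coe_basis]
  change (ρ.face h x : V s) ∈ convexHull ℝ (Set.range (ρ.vertex s))
  rw [e2]
  refine convexHull_mono ?_ (affineCombination_mem_convexHull hw0 hw1)
  rintro _ ⟨i, rfl⟩
  exact Set.mem_range_self _

theorem uniqueDiff_body (s : K.faces) : UniqueDiff (E := ρ.tangent s) (ρ.body s) := by
  intro x hx
  have hconv : Convex ℝ {v : ρ.tangent s | v +ᵥ x ∈ ρ.body s} := by
    have := (convex_convexHull ℝ (Set.range (ρ.vertex s))).affine_preimage
      ((ρ.tangent s).subtype.toAffineMap + AffineMap.const ℝ _ (x : V s))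
    exact this
  refine uniqueDiffOn_convex hconv ?_ 0 (by simpa using hx)
  have hspan : affineSpan ℝ ((fun p : ρ.plane s => p -ᵥ x) '' Set.range (ρ.basis s)) = ⊤ :=
    AffineMap.span_eq_top_of_surjective (AffineEquiv.vaddConst ℝ x).symm.toAffineMap
      (AffineEquiv.vaddConst ℝ x).symm.surjective (ρ.basis s).tot
  refine (interior_convexHull_nonempty_iff_affineSpan_eq_top.2 hspan).mono
    (interior_mono (convexHull_min ?_ hconv))
  rintro _ ⟨_, ⟨i, rfl⟩, rfl⟩
  simpa [body, coe_basis] using subset_convexHull ℝ _ (Set.mem_range_self i)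

/-- The compatible `k`-forms: the families of smooth `k`-forms `u s` on the `|s|`
such that, whenever `t ⊆ s`, the pull-back of `u s` to `|t|` is `u t`. -/
def compatibleSubmodule (k : ℕ) :
    Submodule ℝ (∀ s : K.faces, ρ.body s → ρ.tangent s [⋀^Fin k]→L[ℝ] ℝ) where
  carrier := {u | (∀ s, IsSmoothOn (u s)) ∧
    ∀ (t s : K.faces) (h : t.1 ⊆ s.1), pullback (ρ.face h) (ρ.face_mapsTo h) (u s) = u t}
  zero_mem' := ⟨fun _ => IsSmoothOn.zero, fun _ _ _ => by ext; simp [pullback]⟩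
  add_mem' := fun {u v} hu hv => ⟨fun s => (hu.1 s).add (hv.1 s), fun t s h => by
    rw [Pi.add_apply u v t, ← hu.2 t s h, ← hv.2 t s h]; ext; simp [pullback]⟩
  smul_mem' := fun c u hu => ⟨fun s => (hu.1 s).smul c, fun t s h => by
    rw [Pi.smul_apply c u t, ← hu.2 t s h]; ext; simp [pullback]⟩

/-- The space `Ω^k` of compatible `k`-forms. -/
def compatibleForms (k : ℕ) : Type _ := ρ.compatibleSubmodule k

instance (k : ℕ) : AddCommGroup (ρ.compatibleForms k) :=
  inferInstanceAs (AddCommGroup (ρ.compatibleSubmodule k))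

instance (k : ℕ) : Module ℝ (ρ.compatibleForms k) :=
  inferInstanceAs (Module ℝ (ρ.compatibleSubmodule k))

/-- The exterior derivative of compatible forms, taken simplex by simplex. -/
def d (k : ℕ) : ρ.compatibleForms k →ₗ[ℝ] ρ.compatibleForms (k + 1) where
  toFun u := ⟨fun s => extD (u.1 s), fun s => (u.2.1 s).extD (ρ.uniqueDiff_body s),
    fun t s h => by
      rw [← extD_pullback (ρ.uniqueDiff_body s) (ρ.uniqueDiff_body t) _ _ (u.2.1 s), u.2.2 t s h]⟩
  map_add' u v := Subtype.ext <| funext fun s =>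
    extD_add (ρ.uniqueDiff_body s) (u.2.1 s) (v.2.1 s)
  map_smul' c u := Subtype.ext <| funext fun s => extD_smul (ρ.uniqueDiff_body s) c (u.2.1 s)

theorem d_comp_d (k : ℕ) : ρ.d (k + 1) ∘ₗ ρ.d k = 0 :=
  LinearMap.ext fun u => Subtype.ext <| funext fun s =>
    extD_extD (ρ.uniqueDiff_body s) (u.2.1 s)

/-! ### Lowest order finite elements -/

open Classical in
/-- The restriction to the simplex `s` of the piecewise affine function `λ_i`: the barycentric
coordinate relative to `i` if `i` is a vertex of `s`, and `0` otherwise. -/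
def bary (i : ι) (s : K.faces) : ρ.plane s →ᵃ[ℝ] ℝ :=
  if h : i ∈ s.1 then (ρ.basis s).coord ⟨i, h⟩ else 0

/-- The differential of `λ_i` on the simplex `s`. -/
def dBary (i : ι) (s : K.faces) : ρ.tangent s →L[ℝ] ℝ := affineDeriv (ρ.bary i s)

/-- For a tuple `v 0, …, v k` of vertices, the `k`-form
`k! ∑ i, (-1)^i λ_{v i} dλ_{v 0} ∧ ⋯ (dλ_{v i})^ ⋯ ∧ dλ_{v k}` (the factor with a hat is omitted),
on the affine space generated by `|s|`. -/
def whitneyAux {k : ℕ} (v : Fin (k + 1) → ι) (s : K.faces) (x : ρ.plane s) :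
    ρ.tangent s [⋀^Fin k]→L[ℝ] ℝ :=
  (k.factorial : ℝ) • ∑ i : Fin (k + 1), ((-1) ^ (i : ℕ) * ρ.bary (v i) s x) •
    wedge fun j : Fin k => ρ.dBary (v (i.succAbove j)) s

theorem affineMap_ext {s : K.faces} {W : Type*} [AddCommGroup W] [Module ℝ W]
    {f g : ρ.plane s →ᵃ[ℝ] W} (h : ∀ i, f (ρ.basis s i) = g (ρ.basis s i)) : f = g := by
  ext x
  rw [← (ρ.basis s).affineCombination_coord_eq_self x,
    Finset.map_affineCombination _ _ _ ((ρ.basis s).sum_coord_apply_eq_one x),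
    Finset.map_affineCombination _ _ _ ((ρ.basis s).sum_coord_apply_eq_one x)]
  congr 2
  funext i
  exact h i

open Classical in
theorem bary_vertex (i : ι) (s : K.faces) (j : s.1) :
    ρ.bary i s (ρ.basis s j) = if i = j then 1 else 0 := by
  rw [bary]
  split_ifs with h h' h'
  · subst h'; simp
  · rw [AffineBasis.coord_apply_ne]
    rintro rfl
    exact h' rfl
  · subst h'
    exact absurd j.2 h
  · rfl

theorem bary_comp_face (i : ι) {t s : K.faces} (h : t.1 ⊆ s.1) :
    (ρ.bary i s).comp (ρ.face h) = ρ.bary i t := by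
  apply ρ.affineMap_ext
  intro j
  simp [face_vertex, bary_vertex]

theorem dBary_comp_face (i : ι) {t s : K.faces} (h : t.1 ⊆ s.1) (w : ρ.tangent t) :
    ρ.dBary i s (affineDeriv (ρ.face h) w) = ρ.dBary i t w := by
  rw [dBary, dBary, ← ρ.bary_comp_face i h]
  rfl

theorem bary_vadd (i : ι) (s : K.faces) (x : ρ.plane s) (w : ρ.tangent s) :
    ρ.bary i s (w +ᵥ x) = ρ.dBary i s w + ρ.bary i s x :=
  (ρ.bary i s).map_vadd x w

theorem bary_eq_zero {i : ι} {s : K.faces} (h : i ∉ s.1) : ρ.bary i s = 0 := dif_neg h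

theorem dBary_eq_zero {i : ι} {s : K.faces} (h : i ∉ s.1) : ρ.dBary i s = 0 := by
  rw [dBary, ρ.bary_eq_zero h]
  rfl

theorem isSmooth_whitneyAux {k : ℕ} (v : Fin (k + 1) → ι) (s : K.faces) :
    IsSmooth (ρ.whitneyAux v s) := by
  intro p
  simp only [whitneyAux, bary_vadd]
  fun_prop

theorem pullback_whitneyAux {k : ℕ} (v : Fin (k + 1) → ι) {t s : K.faces} (h : t.1 ⊆ s.1) :
    pullback (ρ.face h) (ρ.face_mapsTo h) (fun x : ρ.body s => ρ.whitneyAux v s x)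
      = fun x : ρ.body t => ρ.whitneyAux v t x := by
  funext x
  ext w
  have hb : ∀ i, ρ.bary i s (ρ.face h x) = ρ.bary i t x := fun i => by
    rw [← ρ.bary_comp_face i h]; rfl
  simp [pullback, whitneyAux, wedge_apply, dBary_comp_face, hb]

/-- The compatible `k`-form
`k! ∑ i, (-1)^i λ_{v i} dλ_{v 0} ∧ ⋯ (dλ_{v i})^ ⋯ ∧ dλ_{v k}`. For `k = 0` this is the function
`λ_{v 0}`. -/
def whitneyForm {k : ℕ} (v : Fin (k + 1) → ι) : ρ.compatibleForms k :=
  ⟨fun s x => ρ.whitneyAux v s x, fun s => ⟨_, ρ.isSmooth_whitneyAux v s, fun _ => rfl⟩,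
    fun _ _ h => ρ.pullback_whitneyAux v h⟩

/-- The form `λ_T` attached to a `k`-simplex `T`, with the orientation of `T`. -/
def simplexForm (σ : Orientation K) {k : ℕ} (T : {T : K.faces // T.1.card = k + 1}) :
    ρ.compatibleForms k :=
  ρ.whitneyForm fun j : Fin (k + 1) => (σ T.1 (Fin.cast T.2.symm j) : ι)

/-- The space `Λ^k` of lowest order finite elements: the span of the `λ_T`, for `T` a
`k`-simplex. -/
def whitneyForms (σ : Orientation K) (k : ℕ) : Submodule ℝ (ρ.compatibleForms k) :=
  Submodule.span ℝ (Set.range (ρ.simplexForm σ (k := k)))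

/-! ### The exterior derivative preserves lowest order finite elements -/

/-- The matrix with rows `(λ_{v i}(x), dλ_{v i}(w 0), …, dλ_{v i}(w (k-1)))`. -/
def whitneyMatrix {k : ℕ} (v : Fin (k + 1) → ι) (s : K.faces) (x : ρ.plane s)
    (w : Fin k → ρ.tangent s) : Matrix (Fin (k + 1)) (Fin (k + 1)) ℝ :=
  Matrix.of fun i => Fin.cons (ρ.bary (v i) s x) fun j => ρ.dBary (v i) s (w j)

theorem whitneyAux_apply {k : ℕ} (v : Fin (k + 1) → ι) (s : K.faces) (x : ρ.plane s)
    (w : Fin k → ρ.tangent s) :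
    ρ.whitneyAux v s x w = (k.factorial : ℝ) * (ρ.whitneyMatrix v s x w).det := by
  rw [Matrix.det_succ_column_zero]
  simp only [whitneyAux, ContinuousAlternatingMap.smul_apply, ContinuousAlternatingMap.sum_apply,
    wedge_apply, smul_eq_mul]
  rfl

theorem whitneyForm_comp_perm {k : ℕ} (v : Fin (k + 1) → ι) (τ : Equiv.Perm (Fin (k + 1))) :
    ρ.whitneyForm (v ∘ τ) = ((Equiv.Perm.sign τ : ℤ) : ℝ) • ρ.whitneyForm v := by
  apply Subtype.ext
  funext s x
  ext w
  change ρ.whitneyAux (v ∘ τ) s x w = ((Equiv.Perm.sign τ : ℤ) : ℝ) * ρ.whitneyAux v s x w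
  rw [whitneyAux_apply, whitneyAux_apply, mul_left_comm, ← Matrix.det_permute]
  rfl

theorem whitneyForm_eq_zero_of_not_injective {k : ℕ} {v : Fin (k + 1) → ι}
    (hv : ¬ Function.Injective v) : ρ.whitneyForm v = 0 := by
  simp only [Function.Injective, not_forall] at hv
  obtain ⟨i, j, hij, hne⟩ := hv
  apply Subtype.ext
  funext s x
  ext w
  change ρ.whitneyAux v s x w = 0
  rw [whitneyAux_apply, Matrix.det_zero_of_row_eq hne, mul_zero]
  have hrow : ∀ a, ρ.whitneyMatrix v s (x : ρ.plane s) w a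
      = (Fin.cons (ρ.bary (v a) s x) fun b => ρ.dBary (v a) s (w b) : Fin (k + 1) → ℝ) :=
    fun _ => rfl
  rw [hrow, hrow, hij]

theorem whitneyForm_eq_zero {k : ℕ} {v : Fin (k + 1) → ι}
    (hv : ∀ s : K.faces, ∃ i, v i ∉ s.1) : ρ.whitneyForm v = 0 := by
  apply Subtype.ext
  funext s x
  ext w
  change ρ.whitneyAux v s x w = 0
  obtain ⟨i, hi⟩ := hv s
  rw [whitneyAux_apply, Matrix.det_eq_zero_of_row_eq_zero i, mul_zero]
  intro j
  simp only [whitneyMatrix, Matrix.of_apply, ρ.bary_eq_zero hi, ρ.dBary_eq_zero hi]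
  refine Fin.cases rfl (fun _ => rfl) j

theorem whitneyForm_mem (σ : Orientation K) {k : ℕ} (v : Fin (k + 1) → ι) :
    ρ.whitneyForm v ∈ ρ.whitneyForms σ k := by
  classical
  by_cases hv : Function.Injective v
  swap
  · rw [ρ.whitneyForm_eq_zero_of_not_injective hv]
    exact zero_mem _
  by_cases hs : ∀ s : K.faces, ∃ i, v i ∉ s.1
  · rw [ρ.whitneyForm_eq_zero hs]
    exact zero_mem _
  push Not at hs
  obtain ⟨s, hs⟩ := hs
  have hT : Finset.univ.image v ∈ K.faces := by
    refine (K.isRelLowerSet_faces s.2).2 ?_ ?_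
    · intro i hi
      obtain ⟨j, -, rfl⟩ := Finset.mem_image.1 hi
      exact hs j
    · exact Finset.univ_nonempty.image v
  have hc : (Finset.univ.image v).card = k + 1 := by
    rw [Finset.card_image_of_injective _ hv, Finset.card_univ, Fintype.card_fin]
  let T : {T : K.faces // T.1.card = k + 1} := ⟨⟨_, hT⟩, hc⟩
  let e : Fin (k + 1) ≃ T.1.1 := Equiv.ofBijective
    (fun j => ⟨v j, Finset.mem_image_of_mem v (Finset.mem_univ j)⟩)
    ⟨fun a b hab => hv (congrArg Subtype.val hab), fun ⟨y, hy⟩ => by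
      obtain ⟨j, -, rfl⟩ := Finset.mem_image.1 hy
      exact ⟨j, rfl⟩⟩
  let τ : Equiv.Perm (Fin (k + 1)) := e.trans ((σ T.1).symm.trans (finCongr T.2))
  have hvτ : v = (fun j : Fin (k + 1) => (σ T.1 (Fin.cast T.2.symm j) : ι)) ∘ τ := by
    funext j
    simp only [τ, Function.comp_apply, Equiv.trans_apply, finCongr_apply, Fin.cast_cast,
      Fin.cast_refl, id_eq, Equiv.apply_symm_apply]
    rfl
  rw [hvτ, whitneyForm_comp_perm]
  exact Submodule.smul_mem _ _ (Submodule.subset_span ⟨T, rfl⟩)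

theorem extDA_whitneyAux {k : ℕ} (v : Fin (k + 1) → ι) (s : K.faces) (x : ρ.plane s) :
    extDA (ρ.whitneyAux v s) x
      = ((k + 1).factorial : ℝ) • wedge fun i => ρ.dBary (v i) s := by
  ext w
  rw [extDA, extDeriv_apply (((ρ.isSmooth_whitneyAux v s x).differentiable (by simp)) 0)]
  have hd : ∀ (w' : Fin k → ρ.tangent s) (z : ρ.tangent s),
      fderiv ℝ (fun y : ρ.tangent s => ρ.whitneyAux v s (y +ᵥ x) w') 0 z
        = (k.factorial : ℝ) * ∑ i : Fin (k + 1), (-1) ^ (i : ℕ) * ρ.dBary (v i) s z *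
          (Matrix.of fun a b => ρ.dBary (v (i.succAbove a)) s (w' b)).det := by
    intro w' z
    have h : HasFDerivAt (fun y : ρ.tangent s => ρ.whitneyAux v s (y +ᵥ x) w')
        ((k.factorial : ℝ) • ∑ i : Fin (k + 1),
          ((-1) ^ (i : ℕ) * (Matrix.of fun a b => ρ.dBary (v (i.succAbove a)) s (w' b)).det) •
            ρ.dBary (v i) s) 0 := by
      have h' : (fun y : ρ.tangent s => ρ.whitneyAux v s (y +ᵥ x) w') = fun y =>
          (k.factorial : ℝ) • ∑ i : Fin (k + 1),
          ((-1) ^ (i : ℕ) * (Matrix.of fun a b => ρ.dBary (v (i.succAbove a)) s (w' b)).det) •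
            (ρ.dBary (v i) s y + ρ.bary (v i) s x) := by
        funext y
        simp only [whitneyAux, ContinuousAlternatingMap.smul_apply,
          ContinuousAlternatingMap.sum_apply, wedge_apply, smul_eq_mul, bary_vadd]
        congr 1
        refine Finset.sum_congr rfl fun i _ => ?_
        ring
      rw [h']
      refine HasFDerivAt.fun_const_smul (HasFDerivAt.fun_sum fun i _ => ?_) _
      exact HasFDerivAt.fun_const_smul (((ρ.dBary (v i) s).hasFDerivAt (x := 0)).add_const
        (ρ.bary (v i) s x)) ((-1) ^ (i : ℕ) *
          (Matrix.of fun a b => ρ.dBary (v (i.succAbove a)) s (w' b)).det)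
    rw [h.fderiv]
    simp only [smul_apply, sum_apply, smul_eq_mul]
    congr 1
    refine Finset.sum_congr rfl fun i _ => ?_
    ring
  simp only [hd, ContinuousAlternatingMap.smul_apply, wedge_apply, smul_eq_mul, zsmul_eq_mul]
  set A : Matrix (Fin (k + 1)) (Fin (k + 1)) ℝ := Matrix.of fun i j => ρ.dBary (v i) s (w j)
    with hA
  have hrow : ∀ i : Fin (k + 1), ∑ j : Fin (k + 1), (-1 : ℝ) ^ (j : ℕ) * ((-1) ^ (i : ℕ) *
      ρ.dBary (v i) s (w j) *
        (Matrix.of fun a b => ρ.dBary (v (i.succAbove a)) s (j.removeNth w b)).det) = A.det := by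
    intro i
    rw [Matrix.det_succ_row A i]
    refine Finset.sum_congr rfl fun j _ => ?_
    rw [pow_add, ← mul_assoc, ← mul_assoc, mul_comm ((-1 : ℝ) ^ (j : ℕ))]
    rfl
  calc _ = (k.factorial : ℝ) * ∑ i : Fin (k + 1), ∑ j : Fin (k + 1), (-1 : ℝ) ^ (j : ℕ) *
        ((-1) ^ (i : ℕ) * ρ.dBary (v i) s (w j) *
        (Matrix.of fun a b => ρ.dBary (v (i.succAbove a)) s (j.removeNth w b)).det) := by
        rw [Finset.sum_comm, Finset.mul_sum]
        refine Finset.sum_congr rfl fun j _ => ?_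
        rw [← Finset.mul_sum]
        push_cast
        ring
    _ = _ := by
        simp only [hrow, Finset.sum_const, Finset.card_univ, Fintype.card_fin, nsmul_eq_mul,
          Nat.factorial_succ]
        push_cast
        ring

/-- On each simplex the exterior derivative of a `0`-form `λ_i` is `dBary i`. -/
theorem d_whitneyForm_zero (v : Fin 1 → ι) (s : K.faces) (x : ρ.body s)
    (w : Fin 1 → ρ.tangent s) :
    (ρ.d 0 (ρ.whitneyForm v)).1 s x w = ρ.dBary (v 0) s (w 0) := by
  change extD (fun x : ρ.body s => ρ.whitneyAux v s x) x w = _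
  rw [extD_eq (ρ.uniqueDiff_body s) (ρ.isSmooth_whitneyAux v s) (fun _ => rfl)]
  change extDA (ρ.whitneyAux v s) x w = _
  rw [extDA_whitneyAux, ContinuousAlternatingMap.smul_apply, wedge_apply]
  simp

theorem val_sum {k : ℕ} (t : Finset ι) (f : ι → ρ.compatibleForms k) :
    (∑ i ∈ t, f i).1 = ∑ i ∈ t, (f i).1 :=
  map_sum (ρ.compatibleSubmodule k).subtype f t

section Finite

variable [Finite K.faces]

/-- The finite set of vertices of a finite simplicial complex. -/
def vertices (K : PreAbstractSimplicialComplex ι) [Finite K.faces] : Finset ι :=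
  (Set.finite_iUnion fun s : K.faces => s.1.finite_toSet).toFinset

theorem sum_bary (s : K.faces) (x : ρ.plane s) : ∑ i ∈ vertices K, ρ.bary i s x = 1 := by
  classical
  have hsub : s.1 ⊆ vertices K := by
    intro j hj
    simp only [vertices, Set.Finite.mem_toFinset, Set.mem_iUnion]
    exact ⟨s, hj⟩
  rw [← Finset.sum_subset hsub (fun i _ hi => by rw [ρ.bary_eq_zero hi]; rfl),
    ← Finset.sum_coe_sort, ← (ρ.basis s).sum_coord_apply_eq_one x]
  refine Finset.sum_congr rfl fun i _ => ?_
  rw [bary, dif_pos i.2]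

theorem sum_dBary (s : K.faces) (x : ρ.plane s) (w : ρ.tangent s) :
    ∑ i ∈ vertices K, ρ.dBary i s w = 0 := by
  have h := ρ.sum_bary s (w +ᵥ x)
  simpa only [bary_vadd, Finset.sum_add_distrib, ρ.sum_bary s x, add_eq_right] using h

theorem d_whitneyForm {k : ℕ} (v : Fin (k + 1) → ι) :
    ρ.d k (ρ.whitneyForm v) = ∑ i ∈ vertices K, ρ.whitneyForm (Fin.cons i v) := by
  apply Subtype.ext
  funext s x
  ext w
  have hl : (ρ.d k (ρ.whitneyForm v)).1 s x = extDA (ρ.whitneyAux v s) x :=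
    extD_eq (ρ.uniqueDiff_body s) (ρ.isSmooth_whitneyAux v s) (fun _ => rfl) x
  have hr : (∑ i ∈ vertices K, ρ.whitneyForm (Fin.cons i v : Fin (k + 2) → ι)).1 s x w
      = ∑ i ∈ vertices K, ρ.whitneyAux (Fin.cons i v : Fin (k + 2) → ι) s x w := by
    rw [val_sum, Finset.sum_apply, Finset.sum_apply,
      ContinuousAlternatingMap.sum_apply]
    rfl
  rw [hl, hr, extDA_whitneyAux]
  simp only [whitneyAux_apply, ContinuousAlternatingMap.smul_apply, wedge_apply, smul_eq_mul,
    ← Finset.mul_sum, Matrix.det_succ_row_zero (ρ.whitneyMatrix _ s (x : ρ.plane s) w)]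
  congr 1
  rw [Finset.sum_comm, Fin.sum_univ_succ, Finset.sum_eq_zero (s := Finset.univ), add_zero]
  · change _ = ∑ i ∈ vertices K, (-1) ^ 0 * ρ.bary i s x *
      (Matrix.of fun i j => ρ.dBary (v i) s (w j)).det
    rw [← Finset.sum_mul, ← Finset.mul_sum, ρ.sum_bary, pow_zero, one_mul, one_mul]
  · intro j _
    change ∑ i ∈ vertices K, (-1) ^ (j.succ : ℕ) * ρ.dBary i s (w j) *
      ((ρ.whitneyMatrix (Fin.cons (v 0) v : Fin (k + 2) → ι) s (x : ρ.plane s) w).submatrix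
        Fin.succ j.succ.succAbove).det = 0
    rw [← Finset.sum_mul, ← Finset.mul_sum, ρ.sum_dBary s x, mul_zero, zero_mul]

theorem d_mem_whitneyForms (σ : Orientation K) {k : ℕ} {u : ρ.compatibleForms k}
    (hu : u ∈ ρ.whitneyForms σ k) : ρ.d k u ∈ ρ.whitneyForms σ (k + 1) := by
  induction hu using Submodule.span_induction with
  | mem u hu =>
    obtain ⟨T, rfl⟩ := hu
    rw [simplexForm, d_whitneyForm]
    exact Submodule.sum_mem _ fun i _ => ρ.whitneyForm_mem σ _
  | zero => rw [map_zero]; exact zero_mem _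
  | add u v _ _ hu hv => rw [map_add]; exact add_mem hu hv
  | smul c u _ hu => rw [map_smul]; exact Submodule.smul_mem _ _ hu

/-! ### The two complexes and the inclusion -/

open CategoryTheory

/-- The complex `Ω^•` of compatible forms. -/
def compatibleComplex : CochainComplex (ModuleCat ℝ) ℕ :=
  CochainComplex.of (fun k => ModuleCat.of ℝ (ρ.compatibleForms k))
    (fun k => ModuleCat.ofHom (ρ.d k))
    (fun k => ModuleCat.hom_ext (ρ.d_comp_d k))

/-- The exterior derivative of lowest order finite elements. -/
def whitneyD (σ : Orientation K) (k : ℕ) : ρ.whitneyForms σ k →ₗ[ℝ] ρ.whitneyForms σ (k + 1) :=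
  (ρ.d k).restrict fun _ hu => ρ.d_mem_whitneyForms σ hu

/-- The complex `Λ^•` of lowest order finite elements. -/
def whitneyComplex (σ : Orientation K) : CochainComplex (ModuleCat ℝ) ℕ :=
  CochainComplex.of (fun k => ModuleCat.of ℝ (ρ.whitneyForms σ k))
    (fun k => ModuleCat.ofHom (ρ.whitneyD σ k))
    (fun k => ModuleCat.hom_ext <| LinearMap.ext fun u => Subtype.ext <|
      LinearMap.congr_fun (ρ.d_comp_d k) u.1)

/-- The inclusion of `Λ^•` into `Ω^•`. -/
def whitneyInclusion (σ : Orientation K) : ρ.whitneyComplex σ ⟶ ρ.compatibleComplex :=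
  CochainComplex.ofHom (fun k => ModuleCat.ofHom (ρ.whitneyForms σ k).subtype) (fun k => by
    simp only [whitneyComplex, compatibleComplex, CochainComplex.of_d]
    rfl)

end Finite

end AffineRealization
end Realization
end PiecewiseForms
end

noncomputable section
namespace PiecewiseForms
open scoped ContDiff

universe u

/-! ### Integrals depending smoothly on a parameter -/

section Parametric

open MeasureTheory intervalIntegral

/-! The inclusion is a homotopy equivalence: there are a projection P of Ω onto Λ
(`whitneyProjection`) and an operator H of degree -1 on Ω (`homotopyMap`) with dH + Hd = 1 - P.

On one simplex let m_i be multiplication by λ_i, e_i = [d, m_i] exterior multiplication by dλ_i, ε_i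
evaluation of functions at the vertex i, and h_i the Poincaré homotopy contracting to i, so that d
h_i + h_i d = 1 - ε_i. A single h_i does not respect restriction to faces missing i, but the average
∑ m_i h_i does, since m_i vanishes on those faces. Averaging has a cost: d(∑ m_i h_i) + (∑ m_i h_i)d
= 1 + ∑ e_i h_i - ∑ m_i ε_i. The error ∑ e_i h_i is removed by iteration. Let E_k be the sum of the
e_{i1}⋯e_{ik} h_{ik}⋯h_{i1} (`extPart`), and let A_{k+1} be the analogous sum with k+1 homotopies
and multiplication by normalized Whitney k-forms (`whitneyPart`). Then dA_{k+1} + A_{k+1}d =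
(k+1)(E_{k+1} + E_k) + W_k (`d_mul_whitneyPart`), where W_k collects the evaluation terms. Hence H =
∑ (-1)^k/(k+1) A_{k+1} telescopes. The last error vanishes because E_k, containing k homotopies,
kills forms of degree less than k. What is left is P, a combination of Whitney forms whose
coefficients are iterated integrals (`whitneyEval_apply`).

On Whitney forms h_i deletes the vertex i and ∑ m_i h_i vanishes, which forces H = 0 on Λ
(`Whitney.homotopyOp_eq_zero`). The homotopy identity then gives P = 1 on Λ, and it also gives Pd =
dP. -/

theorem hasFDerivAt_integral_of_contDiff {E G : Type*} [NormedAddCommGroup E] [NormedSpace ℝ E]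
    [FiniteDimensional ℝ E] [NormedAddCommGroup G] [NormedSpace ℝ G] {F : E × ℝ → G}
    (hF : ContDiff ℝ 1 F) (x₀ : E) :
    HasFDerivAt (fun x => ∫ t in (0 : ℝ)..1, F (x, t))
      (∫ t in (0 : ℝ)..1, (fderiv ℝ F (x₀, t)).comp (ContinuousLinearMap.inl ℝ E ℝ)) x₀ := by
  have hcont : Continuous fun p : E × ℝ =>
      (fderiv ℝ F p).comp (ContinuousLinearMap.inl ℝ E ℝ) :=
    (hF.continuous_fderiv (by simp)).clm_comp continuous_const
  -- In finite dimension the closed ball times [0, 1] is compact, so a constant dominates the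
  -- derivative in the parameter.
  obtain ⟨C, hC⟩ := ((isCompact_closedBall x₀ 1).prod
    (isCompact_Icc (a := (0 : ℝ)) (b := 1))).exists_bound_of_continuousOn hcont.continuousOn
  have hF' : ∀ x, Continuous fun t : ℝ => F (x, t) := fun x => by
    have := hF.continuous
    fun_prop
  refine hasFDerivAt_integral_of_dominated_of_fderiv_le
    (F := fun x t => F (x, t))
    (F' := fun x t => (fderiv ℝ F (x, t)).comp (ContinuousLinearMap.inl ℝ E ℝ))
    (bound := fun _ => C) (Metric.ball_mem_nhds x₀ one_pos)
    (Filter.Eventually.of_forall fun x => (hF' x).aestronglyMeasurable)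
    ((hF' x₀).intervalIntegrable _ _)
    (hcont.comp (Continuous.prodMk_right x₀)).aestronglyMeasurable
    (Filter.Eventually.of_forall fun t ht x hx => ?_) intervalIntegrable_const
    (Filter.Eventually.of_forall fun t _ x _ => ?_)
  · rw [Set.uIoc_of_le zero_le_one] at ht
    exact hC (x, t) ⟨Metric.ball_subset_closedBall hx, ht.1.le, ht.2⟩
  · exact ((hF.differentiable (by simp)) (x, t)).hasFDerivAt.comp x (hasFDerivAt_prodMk_left x t)

/-- Meant for Φ the alternation map, which turns the derivative of a form into its exterior
derivative. -/
theorem map_fderiv_integral {E G H : Type*} [NormedAddCommGroup E] [NormedSpace ℝ E]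
    [FiniteDimensional ℝ E] [NormedAddCommGroup G] [NormedSpace ℝ G] [CompleteSpace G]
    [NormedAddCommGroup H] [NormedSpace ℝ H] [CompleteSpace H] {F : E × ℝ → G}
    (hF : ContDiff ℝ 1 F) (Φ : (E →L[ℝ] G) →L[ℝ] H) (x : E) :
    IntervalIntegrable (fun t : ℝ =>
        Φ ((fderiv ℝ F (x, t)).comp (ContinuousLinearMap.inl ℝ E ℝ))) volume 0 1 ∧
      Φ (fderiv ℝ (fun x => ∫ t in (0 : ℝ)..1, F (x, t)) x)
        = ∫ t in (0 : ℝ)..1, Φ ((fderiv ℝ F (x, t)).comp (ContinuousLinearMap.inl ℝ E ℝ)) := by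
  have hc : Continuous fun t : ℝ => (fderiv ℝ F (x, t)).comp (ContinuousLinearMap.inl ℝ E ℝ) :=
    ((hF.continuous_fderiv (by simp)).clm_comp continuous_const).comp (Continuous.prodMk_right x)
  refine ⟨(Φ.continuous.comp hc).intervalIntegrable _ _, ?_⟩
  rw [(hasFDerivAt_integral_of_contDiff hF x).fderiv]
  exact (Φ.intervalIntegral_comp_comm (hc.intervalIntegrable 0 1)).symm

/-- The derivative is again such an integral, with values in `E →L[ℝ] G`, so the induction must let
`G` vary. The common universe keeps this new target within its range. -/
theorem contDiff_integral {E G : Type u} [NormedAddCommGroup E] [NormedSpace ℝ E]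
    [FiniteDimensional ℝ E] [NormedAddCommGroup G] [NormedSpace ℝ G] {F : E × ℝ → G}
    (hF : ContDiff ℝ ∞ F) : ContDiff ℝ ∞ fun x => ∫ t in (0 : ℝ)..1, F (x, t) := by
  rw [contDiff_infty]
  intro n
  induction n generalizing G with
  | zero =>
    exact contDiff_zero.2 (continuous_iff_continuousAt.2 fun x =>
      (hasFDerivAt_integral_of_contDiff (hF.of_le (by simp)) x).continuousAt)
  | succ n ih =>
    refine (contDiff_succ_iff_hasFDerivAt (n := n)).2 ⟨_, ?_,
      fun x => hasFDerivAt_integral_of_contDiff (hF.of_le (by simp)) x⟩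
    exact ih (F := fun p => (fderiv ℝ F p).comp (ContinuousLinearMap.inl ℝ E ℝ))
      ((hF.fderiv_right (m := ∞) (by simp)).clm_comp contDiff_const)

end Parametric

/-! ### The homotopy operator of the Poincaré lemma -/

section Cone

open MeasureTheory

variable {E : Type u} [NormedAddCommGroup E] [NormedSpace ℝ E] {k : ℕ}

open ContinuousAlternatingMap

/-- The homotopy operator of the Poincaré lemma, for the contraction of `E` to the origin. -/
def cone (g : E → E [⋀^Fin (k + 1)]→L[ℝ] ℝ) (x : E) : E [⋀^Fin k]→L[ℝ] ℝ :=
  ∫ t in (0 : ℝ)..1, t ^ k • (g (t • x)).curryLeft x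

/-- Currying of the first argument, as a continuous linear map. -/
def curryCLM (E : Type u) [NormedAddCommGroup E] [NormedSpace ℝ E] (k : ℕ) :
    (E [⋀^Fin (k + 1)]→L[ℝ] ℝ) →L[ℝ] E →L[ℝ] E [⋀^Fin k]→L[ℝ] ℝ :=
  curryLeftLI.toContinuousLinearMap

/-- Contraction with a vector, as a continuous linear map in the form. -/
def contract (k : ℕ) (x : E) : (E [⋀^Fin (k + 1)]→L[ℝ] ℝ) →L[ℝ] E [⋀^Fin k]→L[ℝ] ℝ :=
  (curryCLM E k).flip x

theorem contract_apply (x : E) (f : E [⋀^Fin (k + 1)]→L[ℝ] ℝ) :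
    contract k x f = f.curryLeft x := rfl

theorem hasFDerivAt_bilinear_smul {G H : Type*} [NormedAddCommGroup G] [NormedSpace ℝ G]
    [NormedAddCommGroup H] [NormedSpace ℝ H] (Φ : G →L[ℝ] E →L[ℝ] H) {g : E → G}
    (hg : Differentiable ℝ g) (c t : ℝ) (x : E) :
    HasFDerivAt (fun y : E => c • Φ (g (t • y)) y)
      (c • (t • (Φ.flip x).comp (fderiv ℝ g (t • x)) + Φ (g (t • x)))) x := by
  have h2 : HasFDerivAt (fun y : E => g (t • y))
      ((fderiv ℝ g (t • x)).comp (t • ContinuousLinearMap.id ℝ E)) x :=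
    HasFDerivAt.comp (f := fun y : E => t • y) x (hg (t • x)).hasFDerivAt
      ((hasFDerivAt_id x).const_smul t)
  have h3 := (Φ.hasFDerivAt.comp x h2).clm_apply (hasFDerivAt_id x)
  refine (h3.const_smul c).congr_fderiv ?_
  ext v
  simp [add_comm]

/-- The linear algebra behind Cartan's formula. In the first alternation, evaluated on (x, v), the
term of index 0 is T x v. The term of index i + 1 cancels the term of index i in the second
alternation, because x occupies one extra slot. -/
theorem alternatize_contract (T : E →L[ℝ] E [⋀^Fin (k + 1)]→L[ℝ] ℝ) (x : E) :
    (alternatizeUncurryFin T).curryLeft x + alternatizeUncurryFin ((contract k x).comp T)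
      = T x := by
  ext v
  have hcons : ∀ i : Fin (k + 1),
      i.succ.removeNth (Matrix.vecCons x v) = Matrix.vecCons x (i.removeNth v) := by
    intro i
    funext j
    refine Fin.cases ?_ (fun j => ?_) j <;> simp [Fin.removeNth, Matrix.vecCons]
  rw [ContinuousAlternatingMap.add_apply, curryLeft_apply_apply, alternatizeUncurryFin_apply,
    alternatizeUncurryFin_apply, Fin.sum_univ_succ, add_assoc, ← Finset.sum_add_distrib,
    Finset.sum_eq_zero, add_zero]
  · simp [Matrix.vecCons]
  · intro i _
    rw [hcons]
    simp [contract_apply, pow_succ]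

theorem contDiff_coneIntegrand {g : E → E [⋀^Fin (k + 1)]→L[ℝ] ℝ} (hg : ContDiff ℝ ∞ g) :
    ContDiff ℝ ∞ fun p : E × ℝ => p.2 ^ k • (g (p.2 • p.1)).curryLeft p.1 := by
  have h1 : ContDiff ℝ ∞ fun p : E × ℝ => g (p.2 • p.1) :=
    hg.comp (contDiff_snd.smul contDiff_fst)
  have h2 : ContDiff ℝ ∞ fun p : E × ℝ =>
      curryCLM E k (g (p.2 • p.1)) :=
    (ContinuousLinearMap.contDiff _).comp h1
  exact (contDiff_snd.pow k).smul (h2.clm_apply contDiff_fst)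

theorem contDiff_cone [FiniteDimensional ℝ E] {g : E → E [⋀^Fin (k + 1)]→L[ℝ] ℝ}
    (hg : ContDiff ℝ ∞ g) :
    ContDiff ℝ ∞ (cone g) :=
  contDiff_integral (contDiff_coneIntegrand hg)

/-- Under the integral sign the left side is the t-derivative of t^(k+1) g(tx):
`alternatize_contract` combines the terms in Dg, and the alternation of the curried form is k + 1
times the form. Since k + 1 > 0, the endpoint t = 0 contributes nothing. -/
theorem extDeriv_cone [FiniteDimensional ℝ E] {g : E → E [⋀^Fin (k + 1)]→L[ℝ] ℝ}
    (hg : ContDiff ℝ ∞ g) (x : E) :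
    extDeriv (cone g) x + cone (extDeriv g) x = g x := by
  have hg' : Differentiable ℝ g := hg.differentiable (by simp)
  have hI := contDiff_coneIntegrand hg
  have hgx : Continuous fun t : ℝ => g (t • x) := by
    have := hg.continuous
    fun_prop
  have hdgx : Continuous fun t : ℝ => fderiv ℝ g (t • x) := by
    have := hg.continuous_fderiv (by simp)
    fun_prop
  have hderiv : ∀ t : ℝ, (fderiv ℝ (fun p : E × ℝ => p.2 ^ k • (g (p.2 • p.1)).curryLeft p.1)
      (x, t)).comp (ContinuousLinearMap.inl ℝ E ℝ)
      = t ^ (k + 1) • (contract k x).comp (fderiv ℝ g (t • x))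
        + t ^ k • (g (t • x)).curryLeft := by
    intro t
    have h1 : HasFDerivAt (fun y : E => t ^ k • (g (t • y)).curryLeft y)
        ((fderiv ℝ (fun p : E × ℝ => p.2 ^ k • (g (p.2 • p.1)).curryLeft p.1)
      (x, t)).comp (ContinuousLinearMap.inl ℝ E ℝ)) x :=
      HasFDerivAt.comp (g := fun p : E × ℝ => p.2 ^ k • (g (p.2 • p.1)).curryLeft p.1)
        (f := fun y : E => (y, t)) x
        ((hI.differentiable (by simp)) (x, t)).hasFDerivAt (hasFDerivAt_prodMk_left x t)
    refine (h1.unique (hasFDerivAt_bilinear_smul (curryCLM E k) hg' (t ^ k) t x)).trans ?_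
    rw [smul_add, smul_smul, pow_succ]
    rfl
  obtain ⟨hint, e1⟩ := map_fderiv_integral (hI.of_le (m := 1) (by simp))
    (alternatizeUncurryFinCLM ℝ E ℝ (n := k)) x
  simp only [hderiv] at hint e1
  change extDeriv (cone g) x = _ at e1
  have hderiv2 : ∀ t : ℝ, HasDerivAt (fun t : ℝ => t ^ (k + 1) • g (t • x))
      (t ^ (k + 1) • fderiv ℝ g (t • x) x + (((k + 1 : ℕ) : ℝ) * t ^ k) • g (t • x)) t := by
    intro t
    have h1 : HasDerivAt (fun t : ℝ => g (t • x)) (fderiv ℝ g (t • x) x) t := by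
      have := (hg' (t • x)).hasFDerivAt.comp_hasDerivAt t ((hasDerivAt_id t).smul_const x)
      simp only [one_smul] at this
      exact this
    have := (hasDerivAt_pow (k + 1) t).smul h1
    rw [Nat.add_sub_cancel] at this
    exact this
  have hFT := intervalIntegral.integral_eq_sub_of_hasDerivAt (a := 0) (b := 1)
    (fun t _ => hderiv2 t) (Continuous.intervalIntegrable (by fun_prop) _ _)
  simp only [one_pow, one_smul, ne_eq, Nat.add_eq_zero_iff, one_ne_zero, and_false,
    not_false_eq_true, zero_pow, zero_smul, sub_zero] at hFT
  rw [← hFT, e1, cone, ← intervalIntegral.integral_add]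
  · congr 1
    funext t
    rw [← alternatize_contract (fderiv ℝ g (t • x)) x]
    have : alternatizeUncurryFin (g (t • x)).curryLeft = (k + 1) • g (t • x) :=
      alternatizeUncurryFin_curryLeft _
    simp only [map_add, map_smul, alternatizeUncurryFinCLM_apply, this, extDeriv, smul_add]
    rw [← Nat.cast_smul_eq_nsmul ℝ, smul_smul, mul_comm (t ^ k)]
    abel
  · exact hint
  · refine Continuous.intervalIntegrable ?_ _ _
    have : Continuous fun t : ℝ => contract (k + 1) x
        (alternatizeUncurryFinCLM ℝ E ℝ (n := k + 1) (fderiv ℝ g (t • x))) :=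
      (ContinuousLinearMap.continuous _).comp ((ContinuousLinearMap.continuous _).comp hdgx)
    exact (continuous_pow _).smul this

/-- In degree 0 there is no power of t to kill the endpoint t = 0; this is the origin of the
evaluation operators. -/
theorem cone_extDeriv_zero {g : E → E [⋀^Fin 0]→L[ℝ] ℝ} (hg : ContDiff ℝ ∞ g) (x : E) :
    cone (extDeriv g) x = g x - g 0 := by
  have hg' : Differentiable ℝ g := hg.differentiable (by simp)
  have hdgx : Continuous fun t : ℝ => fderiv ℝ g (t • x) x := by
    have := hg.continuous_fderiv (by simp)
    fun_prop
  have hderiv : ∀ t : ℝ, HasDerivAt (fun t : ℝ => g (t • x)) (fderiv ℝ g (t • x) x) t := by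
    intro t
    have := (hg' (t • x)).hasFDerivAt.comp_hasDerivAt t ((hasDerivAt_id t).smul_const x)
    simp only [one_smul] at this
    exact this
  have hFT := intervalIntegral.integral_eq_sub_of_hasDerivAt (a := 0) (b := 1)
    (fun t _ => hderiv t) (hdgx.intervalIntegrable _ _)
  simp only [one_smul, zero_smul] at hFT
  rw [← hFT, cone]
  congr 1
  funext t
  ext v
  simp [extDeriv, alternatizeUncurryFin_apply, Subsingleton.elim _ v]

theorem cone_apply {g : E → E [⋀^Fin (k + 1)]→L[ℝ] ℝ} (hg : ContDiff ℝ ∞ g) (x : E)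
    (w : Fin k → E) :
    cone g x w = ∫ t in (0 : ℝ)..1, t ^ k * g (t • x) (Fin.cons x w) := by
  have hc : Continuous fun t : ℝ => t ^ k • (g (t • x)).curryLeft x :=
    (contDiff_coneIntegrand hg).continuous.comp (Continuous.prodMk_right x)
  exact ((ContinuousAlternatingMap.apply ℝ E ℝ w).intervalIntegral_comp_comm
    (hc.intervalIntegrable 0 1)).symm

end Cone

/-! ### Operators on the smooth forms on a subset of an affine space -/

section Operators

variable {E : Type u} {A : Type*} [NormedAddCommGroup E] [NormedSpace ℝ E] [AddTorsor E A]
  {B : Set A} {k : ℕ}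

variable (E) in
/-- The space of smooth `k`-forms on `B`. -/
def smoothForms (B : Set A) (k : ℕ) : Submodule ℝ (B → E [⋀^Fin k]→L[ℝ] ℝ) where
  carrier := {u | IsSmoothOn u}
  zero_mem' := IsSmoothOn.zero
  add_mem' := IsSmoothOn.add
  smul_mem' := fun c _ hu => hu.smul c

variable (E) in
/-- The space of smooth forms on `B`, of all degrees. -/
def Forms (B : Set A) : Type _ := ∀ k, smoothForms E B k

instance : AddCommGroup (Forms E B) := inferInstanceAs (AddCommGroup (∀ k, smoothForms E B k))

instance : Module ℝ (Forms E B) := inferInstanceAs (Module ℝ (∀ k, smoothForms E B k))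

variable (E B) in
/-- The component of degree `k`. -/
def component (k : ℕ) : Forms E B →ₗ[ℝ] smoothForms E B k :=
  LinearMap.proj (φ := fun k => smoothForms E B k) k

/-- A linear map to forms of all degrees, from its components. -/
def ofComponents {M : Type*} [AddCommGroup M] [Module ℝ M] (f : ∀ k, M →ₗ[ℝ] smoothForms E B k) :
    M →ₗ[ℝ] Forms E B :=
  LinearMap.pi (φ := fun k => smoothForms E B k) f

/-- The operator on forms of all degrees with given components of degree `1`. -/
def raise (f : ∀ k, smoothForms E B k →ₗ[ℝ] smoothForms E B (k + 1)) :
    Module.End ℝ (Forms E B) :=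
  ofComponents fun k => match k with
    | 0 => 0
    | k + 1 => f k ∘ₗ component E B k

/-- The operator on forms of all degrees with given components of degree `-1`. -/
def lower (f : ∀ k, smoothForms E B (k + 1) →ₗ[ℝ] smoothForms E B k) :
    Module.End ℝ (Forms E B) :=
  ofComponents fun k => f k ∘ₗ component E B (k + 1)

/-- The operator on forms of all degrees with given components of degree `0`. -/
def diagonal (f : ∀ k, smoothForms E B k →ₗ[ℝ] smoothForms E B k) : Module.End ℝ (Forms E B) :=
  ofComponents fun k => f k ∘ₗ component E B k

/-- The exterior derivative as an operator on forms of all degrees. -/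
def extDOp (hB : UniqueDiff (E := E) B) : Module.End ℝ (Forms E B) :=
  raise fun _ =>
    { toFun := fun u => ⟨extD u.1, u.2.extD hB⟩
      map_add' := fun u v => Subtype.ext (extD_add hB u.2 v.2)
      map_smul' := fun c u => Subtype.ext (extD_smul hB c u.2) }

theorem extDOp_zero (hB : UniqueDiff (E := E) B) (u : Forms E B) : extDOp hB u 0 = 0 := rfl

theorem extDOp_mul_self (hB : UniqueDiff (E := E) B) : extDOp hB * extDOp hB = 0 := by
  ext1 u
  funext k
  match k with
  | 0 => rfl
  | 1 => exact congrFun (map_zero (extDOp hB)) 1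
  | k + 2 => exact Subtype.ext (extD_extD hB (u k).2)

/-- `B` is starlike with respect to its point `p`. -/
structure Starlike (B : Set A) (p : A) : Prop where
  mem : p ∈ B
  segment_mem : ∀ x ∈ B, ∀ t ∈ Set.Icc (0 : ℝ) 1, t • (x -ᵥ p : E) +ᵥ p ∈ B

/-- The homotopy operator for the contraction of `A` to `p`. -/
def coneA (p : A) (f : A → E [⋀^Fin (k + 1)]→L[ℝ] ℝ) (x : A) : E [⋀^Fin k]→L[ℝ] ℝ :=
  cone (fun v : E => f (v +ᵥ p)) (x -ᵥ p)

/-- The homotopy operator for the contraction of `B` to `p`. -/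
def coneOn (p : A) (u : B → E [⋀^Fin (k + 1)]→L[ℝ] ℝ) (x : B) : E [⋀^Fin k]→L[ℝ] ℝ :=
  coneA p (Function.extend Subtype.val u 0) x

/-- The integral only sees the segment from p to x, which stays in B. So the extension by zero is
harmless, and identities on B follow from those for any smooth extension. -/
theorem coneOn_eq {p : A} (hp : Starlike (E := E) B p) {u : B → E [⋀^Fin (k + 1)]→L[ℝ] ℝ}
    {f : A → E [⋀^Fin (k + 1)]→L[ℝ] ℝ} (hu : ∀ x : B, f x = u x) (x : B) :
    coneOn p u x = coneA p f x := by
  refine intervalIntegral.integral_congr fun t ht => ?_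
  rw [Set.uIcc_of_le zero_le_one] at ht
  have := hp.segment_mem x x.2 t ht
  simp only [extend_eq u this]
  rw [← hu]

theorem coneA_vadd (p : A) (f : A → E [⋀^Fin (k + 1)]→L[ℝ] ℝ) :
    (fun v : E => coneA p f (v +ᵥ p)) = cone fun v : E => f (v +ᵥ p) := by
  funext v
  rw [coneA, vadd_vsub]

theorem IsSmooth.coneA [FiniteDimensional ℝ E] (p : A) {f : A → E [⋀^Fin (k + 1)]→L[ℝ] ℝ}
    (hf : IsSmooth f) :
    IsSmooth (coneA p f) := by
  intro q
  have : (fun v : E => PiecewiseForms.coneA p f (v +ᵥ q))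
      = fun v : E => cone (fun v : E => f (v +ᵥ p)) (v + (q -ᵥ p)) := by
    funext v
    rw [PiecewiseForms.coneA, vadd_vsub_assoc]
  rw [this]
  exact (contDiff_cone (hf p)).comp (contDiff_id.add contDiff_const)

theorem extDA_coneA [FiniteDimensional ℝ E] (p : A) {f : A → E [⋀^Fin (k + 1)]→L[ℝ] ℝ}
    (hf : IsSmooth f) (x : A) :
    extDA (coneA p f) x + coneA p (extDA f) x = f x := by
  have h1 := congrFun (extDA_vadd (coneA p f) p) (x -ᵥ p)
  have h2 := extDeriv_cone (hf p) (x -ᵥ p)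
  simp only [vsub_vadd, coneA_vadd] at h1 h2
  rw [h1, coneA, extDA_vadd, h2]

theorem coneA_extDA (p : A) {f : A → E [⋀^Fin 0]→L[ℝ] ℝ} (hf : IsSmooth f) (x : A) :
    coneA p (extDA f) x = f x - f p := by
  rw [coneA, extDA_vadd, cone_extDeriv_zero (hf p), vsub_vadd, zero_vadd]

theorem continuous_coneIntegrand {g : E → E [⋀^Fin (k + 1)]→L[ℝ] ℝ} (hg : ContDiff ℝ ∞ g) (x : E)
    (w : Fin (k + 1) → E) : Continuous fun t : ℝ => t ^ k * g (t • x) w :=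
  (continuous_pow k).mul ((ContinuousAlternatingMap.apply ℝ E ℝ w).continuous.comp
    (hg.continuous.comp (continuous_id.smul continuous_const)))

theorem coneA_add (p : A) {f g : A → E [⋀^Fin (k + 1)]→L[ℝ] ℝ} (hf : IsSmooth f)
    (hg : IsSmooth g) (x : A) : coneA p (f + g) x = coneA p f x + coneA p g x := by
  ext w
  simp only [coneA, ContinuousAlternatingMap.add_apply]
  rw [cone_apply (hf p), cone_apply (hg p), cone_apply ((hf.add hg) p),
    ← intervalIntegral.integral_add]
  · simp [mul_add]
  · exact (continuous_coneIntegrand (hf p) _ _).intervalIntegrable _ _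
  · exact (continuous_coneIntegrand (hg p) _ _).intervalIntegrable _ _

theorem coneA_smul (p : A) (c : ℝ) (f : A → E [⋀^Fin (k + 1)]→L[ℝ] ℝ) (x : A) :
    coneA p (c • f) x = c • coneA p f x := by
  rw [coneA, coneA, cone, cone, ← intervalIntegral.integral_smul]
  refine intervalIntegral.integral_congr fun t _ => ?_
  exact (congrArg (fun y => t ^ k • y) ((contract k (x -ᵥ p : E)).map_smul c _)).trans
    (smul_comm _ _ _)

/-- The homotopy operator for the contraction of `B` to `p`, on forms of all degrees. -/
def coneOp [FiniteDimensional ℝ E] {p : A} (hp : Starlike (E := E) B p) : Module.End ℝ (Forms E B)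
    :=
  lower fun _ =>
    { toFun := fun u => ⟨coneOn p u.1, by
        obtain ⟨f, hf, hfu⟩ := u.2
        exact ⟨_, hf.coneA p, fun x => (coneOn_eq hp hfu x).symm⟩⟩
      map_add' := fun u v => Subtype.ext <| funext fun x => by
        obtain ⟨f, hf, hfu⟩ := u.2
        obtain ⟨g, hg, hgv⟩ := v.2
        change coneOn p (u.1 + v.1) x = coneOn p u.1 x + coneOn p v.1 x
        rw [coneOn_eq hp hfu, coneOn_eq hp hgv, ← coneA_add p hf hg]
        exact coneOn_eq hp (fun x => by simp [hfu, hgv]) x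
      map_smul' := fun c u => Subtype.ext <| funext fun x => by
        obtain ⟨f, hf, hfu⟩ := u.2
        change coneOn p (c • u.1) x = c • coneOn p u.1 x
        rw [coneOn_eq hp hfu, ← coneA_smul]
        exact coneOn_eq hp (fun x => by simp [hfu]) x }

/-- The value at `p` of forms of degree `0`, on forms of all degrees. -/
def evalOp {p : A} (hp : p ∈ B) : Module.End ℝ (Forms E B) :=
  diagonal fun k => match k with
    | 0 =>
      { toFun := fun u => ⟨fun _ => u.1 ⟨p, hp⟩, fun _ => u.1 ⟨p, hp⟩, fun _ => contDiff_const,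
          fun _ => rfl⟩
        map_add' := fun _ _ => rfl
        map_smul' := fun _ _ => rfl }
    | _ + 1 => 0

theorem extDOp_mul_coneOp [FiniteDimensional ℝ E] (hB : UniqueDiff (E := E) B) {p : A}
    (hp : Starlike (E := E) B p) :
    extDOp hB * coneOp hp + coneOp hp * extDOp hB = 1 - evalOp hp.mem := by
  ext1 u
  funext k
  apply Subtype.ext
  funext x
  obtain ⟨f, hf, hfu⟩ := (u k).2
  have h1 : coneOn p (extD (u k).1) x = coneA p (extDA f) x :=
    coneOn_eq hp (fun y => (extD_eq hB hf hfu y).symm) x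
  match k with
  | 0 =>
    change 0 + coneOn p (extD (u 0).1) x = (u 0).1 x - (u 0).1 ⟨p, hp.mem⟩
    rw [h1, coneA_extDA p hf, zero_add, hfu, ← hfu ⟨p, hp.mem⟩]
  | k + 1 =>
    change extD (coneOn p (u (k + 1)).1) x + coneOn p (extD (u (k + 1)).1) x
      = (u (k + 1)).1 x - 0
    rw [h1, extD_eq hB (hf.coneA p) (fun y => (coneOn_eq hp hfu y).symm), sub_zero, ← hfu]
    exact extDA_coneA p hf x

/-- Evaluation produces only a component of degree 0, which every homotopy operator kills. -/
theorem coneOp_mul_evalOp [FiniteDimensional ℝ E] {p q : A} (hp : Starlike (E := E) B p)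
    (hq : q ∈ B) :
    coneOp hp * evalOp hq = 0 := by
  ext1 u
  funext k
  exact congrFun (map_zero (coneOp hp)) k

/-- Multiplication of a form by an affine function. -/
def mulA (l : A →ᵃ[ℝ] ℝ) (f : A → E [⋀^Fin k]→L[ℝ] ℝ) (x : A) : E [⋀^Fin k]→L[ℝ] ℝ := l x • f x

theorem affine_vadd [FiniteDimensional ℝ E] (l : A →ᵃ[ℝ] ℝ) (v : E) (p : A) : l
    (v +ᵥ p) = affineDeriv l v + l p :=
  l.map_vadd p v

theorem IsSmooth.mulA [FiniteDimensional ℝ E] (l : A →ᵃ[ℝ] ℝ) {f : A → E [⋀^Fin k]→L[ℝ] ℝ}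
    (hf : IsSmooth f) :
    IsSmooth (mulA l f) := by
  intro p
  simp only [PiecewiseForms.mulA, affine_vadd]
  exact ((affineDeriv l).contDiff.add contDiff_const).smul (hf p)

theorem extDA_mulA [FiniteDimensional ℝ E] (l : A →ᵃ[ℝ] ℝ) {f : A → E [⋀^Fin k]→L[ℝ] ℝ}
    (hf : IsSmooth f) (x : A) :
    extDA (mulA l f) x = l x • extDA f x
      + ContinuousAlternatingMap.alternatizeUncurryFin ((affineDeriv l).smulRight (f x)) := by
  have hd : HasFDerivAt (fun v : E => f (v +ᵥ x)) (fderiv ℝ (fun v : E => f (v +ᵥ x)) 0) 0 :=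
    ((hf x).differentiable (by simp) 0).hasFDerivAt
  have hl : HasFDerivAt (fun v : E => l (v +ᵥ x)) (affineDeriv l) 0 := by
    simp only [affine_vadd]
    exact (affineDeriv l).hasFDerivAt.add_const _
  have := (hl.smul hd).fderiv
  simp only [zero_vadd] at this
  refine (congrArg ContinuousAlternatingMap.alternatizeUncurryFin this).trans ?_
  exact (ContinuousAlternatingMap.alternatizeUncurryFinCLM ℝ E ℝ (n := k)).map_add _ _ |>.trans
    (congrArg (· + _)
      ((ContinuousAlternatingMap.alternatizeUncurryFinCLM ℝ E ℝ (n := k)).map_smul _ _))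

/-- Multiplication of smooth forms by an affine function. -/
def mulForm [FiniteDimensional ℝ E] (l : A →ᵃ[ℝ] ℝ) :
    smoothForms E B k →ₗ[ℝ] smoothForms E B k where
  toFun u := ⟨fun x => l x • u.1 x, by
    obtain ⟨f, hf, hfu⟩ := u.2
    exact ⟨_, hf.mulA l, fun x => by rw [mulA, hfu]⟩⟩
  map_add' u v := Subtype.ext <| funext fun x => smul_add _ _ _
  map_smul' c u := Subtype.ext <| funext fun x => by
    change (l x : ℝ) • c • u.1 x = c • (l x : ℝ) • u.1 x
    exact smul_comm _ _ _

/-- Multiplication by an affine function, on forms of all degrees. -/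
def mulOp [FiniteDimensional ℝ E] (B : Set A) (l : A →ᵃ[ℝ] ℝ) : Module.End ℝ (Forms E B) :=
  diagonal fun _ => mulForm l

/-- Leibniz rule: the derivatives of u cancel in the commutator, leaving exterior multiplication by
the constant form dl. -/
theorem extDOp_mul_sub [FiniteDimensional ℝ E] (hB : UniqueDiff (E := E) B) (l : A →ᵃ[ℝ] ℝ)
    (u : Forms E B) (k : ℕ)
    (x : B) (w : Fin (k + 1) → E) :
    ((extDOp hB * mulOp B l - mulOp B l * extDOp hB) u (k + 1)).1 x w
      = ∑ i : Fin (k + 1), (-1) ^ (i : ℕ) * (affineDeriv l (w i) * (u k).1 x (i.removeNth w)) := by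
  obtain ⟨f, hf, hfu⟩ := (u k).2
  change (extD (fun x : B => l x • (u k).1 x) x - l x • extD (u k).1 x) w = _
  rw [extD_eq hB hf hfu, extD_eq hB (hf.mulA l) (fun x => by rw [mulA, hfu])]
  change (extDA (mulA l f) x - l x • extDA f x) w = _
  rw [extDA_mulA l hf, add_sub_cancel_left, ContinuousAlternatingMap.alternatizeUncurryFin_apply,
    ← hfu]
  simp

theorem extDOp_mul_sub_zero [FiniteDimensional ℝ E] (hB : UniqueDiff (E := E) B) (l : A →ᵃ[ℝ] ℝ)
    (u : Forms E B) :
    (extDOp hB * mulOp B l - mulOp B l * extDOp hB) u 0 = 0 := by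
  apply Subtype.ext
  funext x
  change (0 : E [⋀^Fin 0]→L[ℝ] ℝ) - l x • (0 : E [⋀^Fin 0]→L[ℝ] ℝ) = 0
  rw [smul_zero, sub_zero]

/-! Pull-back -/

variable {E' : Type u} {A' : Type*} [NormedAddCommGroup E'] [NormedSpace ℝ E']
  [FiniteDimensional ℝ E'] [AddTorsor E' A'] {B' : Set A'}

theorem IsSmoothOn.pullback (g : A' →ᵃ[ℝ] A) (hg : Set.MapsTo g B' B)
    {u : B → E [⋀^Fin k]→L[ℝ] ℝ} (hu : IsSmoothOn u) : IsSmoothOn (pullback g hg u) := by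
  obtain ⟨f, hf, hfu⟩ := hu
  refine ⟨fun p : A' => (f (g p)).compContinuousLinearMap (affineDeriv g), fun p => ?_,
    fun x => by simp [PiecewiseForms.pullback, ← hfu]⟩
  have h1 : ContDiff ℝ ∞ (fun v : E' => f (affineDeriv g v +ᵥ g p)) :=
    (hf (g p)).comp (affineDeriv g).contDiff
  have h2 := (ContinuousAlternatingMap.compContinuousLinearMapCLM (ι := Fin k) (F := ℝ)
    (affineDeriv g)).contDiff.comp h1 (n := ∞)
  simpa [Function.comp_def, affineDeriv] using h2

/-- The pull-back of forms of all degrees. -/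
def pullbackOp (g : A' →ᵃ[ℝ] A) (hg : Set.MapsTo g B' B) : Forms E B →ₗ[ℝ] Forms E' B' :=
  ofComponents fun k =>
    { toFun := fun u => ⟨pullback g hg u.1, u.2.pullback g hg⟩
      map_add' := fun _ _ => Subtype.ext <| funext fun _ => by ext; simp [pullback]
      map_smul' := fun _ _ => Subtype.ext <| funext fun _ => by ext; simp [pullback] } ∘ₗ
        component E B k

theorem pullbackOp_apply (g : A' →ᵃ[ℝ] A) (hg : Set.MapsTo g B' B) (u : Forms E B) (k : ℕ) :
    (pullbackOp g hg u k).1 = pullback g hg (u k).1 := rfl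

theorem pullbackOp_extDOp (hB : UniqueDiff (E := E) B) (hB' : UniqueDiff (E := E') B')
    (g : A' →ᵃ[ℝ] A) (hg : Set.MapsTo g B' B) (u : Forms E B) :
    pullbackOp g hg (extDOp hB u) = extDOp hB' (pullbackOp g hg u) := by
  funext k
  apply Subtype.ext
  match k with
  | 0 => funext x; ext; simp [pullbackOp_apply, extDOp_zero, pullback]
  | k + 1 => exact (extD_pullback hB hB' g hg (u k).2).symm

theorem pullbackOp_mulOp [FiniteDimensional ℝ E] (g : A' →ᵃ[ℝ] A) (hg : Set.MapsTo g B' B)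
    (l : A →ᵃ[ℝ] ℝ) (u : Forms E B) :
    pullbackOp g hg (mulOp B l u) = mulOp B' (l.comp g) (pullbackOp g hg u) := by
  funext k
  apply Subtype.ext
  funext x
  ext w
  rfl

/-- An affine map carries segments issuing from p' to segments issuing from p, with their parameter
and their radial vectors. -/
theorem pullbackOp_coneOp [FiniteDimensional ℝ E] (g : A' →ᵃ[ℝ] A) (hg : Set.MapsTo g B' B)
    {p : A} {p' : A'} (hp : Starlike (E := E) B p) (hp' : Starlike (E := E') B' p')
    (hpp' : g p' = p) (u : Forms E B) :
    pullbackOp g hg (coneOp hp u) = coneOp hp' (pullbackOp g hg u) := by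
  subst hpp'
  funext k
  apply Subtype.ext
  funext x
  ext w
  obtain ⟨f, hf, hfu⟩ := (u (k + 1)).2
  obtain ⟨f', hf', hfu'⟩ := (pullbackOp g hg u (k + 1)).2
  change coneOn (g p') (u (k + 1)).1 ⟨g x, hg x.2⟩ (affineDeriv g ∘ w)
    = coneOn p' (pullbackOp g hg u (k + 1)).1 x w
  rw [coneOn_eq hp hfu, coneOn_eq hp' hfu', coneA, coneA, cone_apply (hf _), cone_apply (hf' _)]
  refine intervalIntegral.integral_congr fun t ht => ?_
  rw [Set.uIcc_of_le zero_le_one] at ht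
  have hx := hp'.segment_mem x x.2 t ht
  have h1 : g (t • ((x : A') -ᵥ p') +ᵥ p') = t • (g x -ᵥ g p') +ᵥ g p' := by
    rw [g.map_vadd, map_smul, g.linearMap_vsub]
  have h2 : f' (t • ((x : A') -ᵥ p') +ᵥ p')
      = (f (t • (g x -ᵥ g p') +ᵥ g p')).compContinuousLinearMap (affineDeriv g) := by
    rw [hfu' ⟨_, hx⟩, pullbackOp_apply, pullback]
    congr 1
    rw [← hfu]
    exact congrArg f h1
  change t ^ k * _ = t ^ k * _
  simp only [h2]
  rw [ContinuousAlternatingMap.compContinuousLinearMap_apply]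
  congr 2
  funext j
  refine Fin.cases ?_ (fun j => rfl) j
  exact (g.linearMap_vsub _ _).symm

end Operators

/-! ### Averaging contractions by a partition of unity -/

/-- A ring of operators containing a differential `d`, multiplications by a partition of unity
`m i`, and homotopy operators `h i` relating the identity to projections `1 - ε i`. -/
structure Contractions (ι R : Type*) [Ring R] where
  index : Finset ι
  d : R
  m : ι → R
  h : ι → R
  ε : ι → R
  d_mul_d : d * d = 0
  sum_m : ∑ i ∈ index, m i = 1
  homotopy : ∀ i, d * h i + h i * d = 1 - ε i
  h_mul_ε : ∀ i j, h i * ε j = 0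

namespace Contractions

/-! ### Commutators of the averaged operators, in an abstract ring -/

section Ring

variable {ι R : Type*} [Ring R] (C : Contractions ι R)

/-- Exterior multiplication by the differential of the function `i`. -/
def e (i : ι) : R := C.d * C.m i - C.m i * C.d

/-- The operator `∑ i, e i * X * h i`. -/
def extSum (X : R) : R := ∑ i ∈ C.index, C.e i * X * C.h i

/-- The operator `∑ i, m i * X * h i`. -/
def mulSum (X : R) : R := ∑ i ∈ C.index, C.m i * X * C.h i

/-- The sum of the `e i₁ ⋯ e iₖ * h iₖ ⋯ h i₁`. -/
def extPart : ℕ → R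
  | 0 => 1
  | k + 1 => C.extSum (extPart k)

/-- The sum of the `A i₁ ⋯ iₖ * h iₖ ⋯ h i₁`, for the operators `A` of multiplication by normalized
Whitney forms. -/
def whitneyPart : ℕ → R
  | 0 => 0
  | k + 1 => C.mulSum (extPart C k) - C.extSum (whitneyPart k)

/-- The commutator of `d` and `extPart (k + 1)`. -/
def extEval : ℕ → R
  | 0 => ∑ i ∈ C.index, C.e i * C.ε i
  | k + 1 => -C.extSum (extEval k)

/-- The projections to Whitney forms, up to normalization. -/
def whitneyEval : ℕ → R
  | 0 => -∑ i ∈ C.index, C.m i * C.ε i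
  | k + 1 => C.mulSum (extEval C k) + C.extSum (whitneyEval k)

theorem sum_e : ∑ i ∈ C.index, C.e i = 0 := by
  simp only [e, Finset.sum_sub_distrib, ← Finset.mul_sum, ← Finset.sum_mul, C.sum_m]
  simp

theorem d_mul_m (i : ι) : C.d * C.m i = C.e i + C.m i * C.d := by
  rw [e]
  abel

theorem d_mul_e (i : ι) : C.d * C.e i = -(C.e i * C.d) := by
  have h1 : C.d * (C.d * C.m i) = 0 := by rw [← mul_assoc, C.d_mul_d, zero_mul]
  have h2 : C.m i * C.d * C.d = 0 := by rw [mul_assoc, C.d_mul_d, mul_zero]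
  rw [e, mul_sub, sub_mul, h1, h2]
  noncomm_ring

theorem h_mul_d (i : ι) : C.h i * C.d = 1 - C.ε i - C.d * C.h i := by
  rw [← C.homotopy i]
  abel

theorem d_mul_extSum (X : R) : C.d * C.extSum X = -(C.extSum (C.d * X)) := by
  rw [extSum, extSum, Finset.mul_sum, ← Finset.sum_neg_distrib]
  refine Finset.sum_congr rfl fun i _ => ?_
  rw [← mul_assoc, ← mul_assoc, C.d_mul_e]
  noncomm_ring

/-- Moving d to the left of h_i with the homotopy formula leaves a term (∑ e_i) X, which is zero
since the m_i sum to 1. -/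
theorem extSum_mul_d (X : R) :
    C.extSum X * C.d = -(C.extSum (X * C.d)) - ∑ i ∈ C.index, C.e i * (X * C.ε i) := by
  have h : ∀ i, C.e i * X * C.h i * C.d
      = C.e i * X - C.e i * (X * C.d) * C.h i - C.e i * (X * C.ε i) := by
    intro i
    rw [mul_assoc _ (C.h i), C.h_mul_d]
    noncomm_ring
  rw [extSum, extSum, Finset.sum_mul]
  simp only [h, Finset.sum_sub_distrib]
  rw [← Finset.sum_mul, C.sum_e, zero_mul, zero_sub]

theorem d_mul_mulSum (X : R) : C.d * C.mulSum X = C.extSum X + C.mulSum (C.d * X) := by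
  rw [extSum, mulSum, mulSum, Finset.mul_sum, ← Finset.sum_add_distrib]
  refine Finset.sum_congr rfl fun i _ => ?_
  rw [← mul_assoc, ← mul_assoc, C.d_mul_m]
  noncomm_ring

/-- Here the corresponding term is (∑ m_i) X = X; it is what produces the identity in the homotopy
formula. -/
theorem mulSum_mul_d (X : R) :
    C.mulSum X * C.d = X - C.mulSum (X * C.d) - ∑ i ∈ C.index, C.m i * (X * C.ε i) := by
  have h : ∀ i, C.m i * X * C.h i * C.d
      = C.m i * X - C.m i * (X * C.d) * C.h i - C.m i * (X * C.ε i) := by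
    intro i
    rw [mul_assoc _ (C.h i), C.h_mul_d]
    noncomm_ring
  rw [mulSum, mulSum, Finset.sum_mul]
  simp only [h, Finset.sum_sub_distrib]
  rw [← Finset.sum_mul, C.sum_m, one_mul]

/-- Every summand ends in h_i ε_j = 0. Consequently new evaluation terms arise only at the first
stage of each recursion. -/
theorem extSum_mul_ε (X : R) (j : ι) : C.extSum X * C.ε j = 0 := by
  rw [extSum, Finset.sum_mul]
  exact Finset.sum_eq_zero fun i _ => by rw [mul_assoc, C.h_mul_ε, mul_zero]

theorem mulSum_mul_ε (X : R) (j : ι) : C.mulSum X * C.ε j = 0 := by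
  rw [mulSum, Finset.sum_mul]
  exact Finset.sum_eq_zero fun i _ => by rw [mul_assoc, C.h_mul_ε, mul_zero]

theorem extPart_succ_mul_ε (k : ℕ) (j : ι) : C.extPart (k + 1) * C.ε j = 0 := C.extSum_mul_ε _ j

theorem whitneyPart_mul_ε (k : ℕ) (j : ι) : C.whitneyPart k * C.ε j = 0 := by
  cases k with
  | zero => exact zero_mul _
  | succ k => rw [whitneyPart, sub_mul, C.extSum_mul_ε, C.mulSum_mul_ε, sub_zero]

theorem extSum_add (X Y : R) : C.extSum (X + Y) = C.extSum X + C.extSum Y := by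
  simp [extSum, mul_add, add_mul, Finset.sum_add_distrib]

theorem extSum_sub (X Y : R) : C.extSum (X - Y) = C.extSum X - C.extSum Y := by
  simp [extSum, mul_sub, sub_mul, Finset.sum_sub_distrib]

theorem extSum_nsmul (n : ℕ) (X : R) : C.extSum (n • X) = n • C.extSum X := by
  rw [extSum, extSum, Finset.smul_sum]
  exact Finset.sum_congr rfl fun i _ => by rw [mul_smul_comm, smul_mul_assoc]

theorem mulSum_sub (X Y : R) : C.mulSum (X - Y) = C.mulSum X - C.mulSum Y := by
  simp [mulSum, mul_sub, sub_mul, Finset.sum_sub_distrib]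

theorem d_mul_extPart (k : ℕ) :
    C.d * C.extPart (k + 1) - C.extPart (k + 1) * C.d = C.extEval k := by
  induction k with
  | zero =>
    rw [extPart, d_mul_extSum, extSum_mul_d]
    simp [extPart, extEval]
  | succ k ih =>
    rw [extPart, d_mul_extSum, extSum_mul_d, extEval, ← ih, extSum_sub]
    simp only [extPart_succ_mul_ε, mul_zero, Finset.sum_const_zero]
    abel

/-- By `key`, each stage creates one new copy of E_{k+1} + E_k, while `extSum` raises the index of
the copies already present; hence the factor k + 1. -/
theorem d_mul_whitneyPart (k : ℕ) :
    C.d * C.whitneyPart (k + 1) + C.whitneyPart (k + 1) * C.d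
      = (k + 1) • (C.extPart (k + 1) + C.extPart k) + C.whitneyEval k := by
  have key : ∀ k, C.d * C.whitneyPart (k + 1) + C.whitneyPart (k + 1) * C.d
      = C.extPart (k + 1) + C.extPart k - ∑ i ∈ C.index, C.m i * (C.extPart k * C.ε i)
        + C.mulSum (C.d * C.extPart k - C.extPart k * C.d)
        + C.extSum (C.d * C.whitneyPart k + C.whitneyPart k * C.d) := by
    intro k
    have h := C.whitneyPart_mul_ε k
    rw [whitneyPart, mul_sub, sub_mul, d_mul_extSum, extSum_mul_d, d_mul_mulSum, mulSum_mul_d,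
      mulSum_sub, extSum_add]
    simp only [h, mul_zero, Finset.sum_const_zero, extPart]
    abel
  induction k with
  | zero =>
    rw [key]
    simp [whitneyPart, extPart, extSum, mulSum, whitneyEval]
    abel
  | succ k ih =>
    rw [key, ih, d_mul_extPart, extSum_add, extSum_nsmul, extSum_add, whitneyEval,
      succ_nsmul _ (k + 1)]
    simp only [extPart_succ_mul_ε, mul_zero, Finset.sum_const_zero]
    simp only [extPart]
    abel

variable [Algebra ℝ R]

/-- The homotopy operator, truncated. -/
def homotopyOp (M : ℕ) : R :=
  ∑ k ∈ Finset.range M, ((-1 : ℝ) ^ k / (k + 1)) • C.whitneyPart (k + 1)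

/-- The projection to Whitney forms, truncated. -/
def projectionOp (M : ℕ) : R :=
  -∑ k ∈ Finset.range M, ((-1 : ℝ) ^ k / (k + 1)) • C.whitneyEval k

/-- The weights (-1)^k/(k+1) cancel the factor k + 1 of `d_mul_whitneyPart`, and the alternating sum
of the E_{k+1} + E_k telescopes. -/
theorem d_mul_homotopyOp (M : ℕ) :
    C.d * C.homotopyOp M + C.homotopyOp M * C.d
      = 1 - (-1 : ℝ) ^ M • C.extPart M - C.projectionOp M := by
  induction M with
  | zero => simp [homotopyOp, projectionOp, extPart]
  | succ M ih =>
    have h := C.d_mul_whitneyPart M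
    have hM : ((M : ℝ) + 1) ≠ 0 := by positivity
    have h' := congrArg (fun X => ((-1 : ℝ) ^ M / (M + 1)) • X) h
    simp only [smul_add, ← Nat.cast_smul_eq_nsmul ℝ, smul_smul] at h'
    push_cast at h'
    rw [div_mul_cancel₀ _ hM] at h'
    rw [homotopyOp, projectionOp, Finset.sum_range_succ, Finset.sum_range_succ, ← homotopyOp,
      mul_add, add_mul, add_add_add_comm, ih, mul_smul_comm, smul_mul_assoc, h', projectionOp,
      pow_succ]
    simp only [mul_neg_one, neg_smul]
    abel

end Ring

/-! ### Action on graded spaces and on Whitney subspaces -/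

section Module

variable {ι W : Type*} [AddCommGroup W] [Module ℝ W] (C : Contractions ι (Module.End ℝ W))

theorem extSum_apply (X : Module.End ℝ W) (u : W) :
    C.extSum X u = ∑ i ∈ C.index, C.e i (X (C.h i u)) := by
  simp [extSum]

theorem mulSum_apply (X : Module.End ℝ W) (u : W) :
    C.mulSum X u = ∑ i ∈ C.index, C.m i (X (C.h i u)) := by
  simp [mulSum]

/-- A grading with respect to which the homotopy operators have degree `-1`. -/
structure Lowers (G : ℕ → Submodule ℝ W) : Prop where
  zero : ∀ i, ∀ u ∈ G 0, C.h i u = 0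
  succ : ∀ i q, ∀ u ∈ G (q + 1), C.h i u ∈ G q

variable {C}

theorem Lowers.extPart_eq_zero {G : ℕ → Submodule ℝ W} (hG : C.Lowers G) {k q : ℕ} (hq : q < k)
    {u : W} (hu : u ∈ G q) : C.extPart k u = 0 := by
  induction k generalizing q u with
  | zero => omega
  | succ k ih =>
    rw [extPart, extSum_apply]
    refine Finset.sum_eq_zero fun i _ => ?_
    cases q with
    | zero => rw [hG.zero i u hu, map_zero, map_zero]
    | succ q => rw [ih (by omega) (hG.succ i q u hu), map_zero]

theorem Lowers.whitneyPart_eq_zero {G : ℕ → Submodule ℝ W} (hG : C.Lowers G) {k q : ℕ}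
    (hq : q < k) {u : W} (hu : u ∈ G q) : C.whitneyPart k u = 0 := by
  induction k generalizing q u with
  | zero => omega
  | succ k ih =>
    rw [whitneyPart, LinearMap.sub_apply, extSum_apply, mulSum_apply, ← Finset.sum_sub_distrib]
    refine Finset.sum_eq_zero fun i _ => ?_
    cases q with
    | zero => simp [hG.zero i u hu]
    | succ q =>
      rw [ih (by omega) (hG.succ i q u hu), hG.extPart_eq_zero (by omega) (hG.succ i q u hu)]
      simp

theorem Lowers.homotopyOp_succ {G : ℕ → Submodule ℝ W} (hG : C.Lowers G) {M q : ℕ} (hq : q ≤ M)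
    {u : W} (hu : u ∈ G q) : C.homotopyOp (M + 1) u = C.homotopyOp M u := by
  rw [homotopyOp, homotopyOp, Finset.sum_range_succ, LinearMap.add_apply, LinearMap.smul_apply,
    hG.whitneyPart_eq_zero (by omega) hu, smul_zero, add_zero]

variable (C)

/-- Submodules behaving like the Whitney forms: the homotopy operators preserve them and vanish on
them when averaged. -/
structure Whitney (G : ℕ → Submodule ℝ W) : Prop extends C.Lowers G where
  d_mem : ∀ q, ∀ u ∈ G q, C.d u ∈ G (q + 1)
  ε_succ : ∀ i q, ∀ u ∈ G (q + 1), C.ε i u = 0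
  sum_m_h : ∀ q, ∀ u ∈ G q, ∑ i ∈ C.index, C.m i (C.h i u) = 0

variable {C}

/-- The averaged homotopy vanishes on u and on du, so its anticommutator with d vanishes on u. That
anticommutator is 1 + ∑ e_i h_i, the evaluations being zero in positive degree. -/
theorem Whitney.sum_e_h {G : ℕ → Submodule ℝ W} (hG : C.Whitney G) {q : ℕ} {u : W}
    (hu : u ∈ G (q + 1)) : ∑ i ∈ C.index, C.e i (C.h i u) = -u := by
  have h1 := hG.sum_m_h _ u hu
  have h2 := hG.sum_m_h _ _ (hG.d_mem _ u hu)
  have h3 := LinearMap.congr_fun (C.d_mul_mulSum 1) u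
  have h4 := LinearMap.congr_fun (C.mulSum_mul_d 1) u
  have h5 : ∑ i ∈ C.index, C.m i (C.ε i u) = 0 :=
    Finset.sum_eq_zero fun i _ => by rw [hG.ε_succ i q u hu, map_zero]
  simp only [Module.End.mul_apply, LinearMap.add_apply, LinearMap.sub_apply, mulSum_apply,
    extSum_apply, Module.End.one_apply, h1, h2, map_zero, one_mul, mul_one, LinearMap.sum_apply,
    h5, sub_zero] at h3 h4
  rw [← sub_eq_zero.1 h4.symm] at h3
  exact eq_neg_of_add_eq_zero_left h3.symm

/-- The value of the scalar is irrelevant. Being the same for all h_i u, it can be taken out of ∑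
m_i E_k h_i u, which reduces that sum to ∑ m_i h_i u = 0. -/
theorem Whitney.exists_extPart {G : ℕ → Submodule ℝ W} (hG : C.Whitney G) (k q : ℕ) :
    ∃ c : ℝ, ∀ u ∈ G q, C.extPart k u = c • u := by
  induction k generalizing q with
  | zero => exact ⟨1, fun u _ => (one_smul _ _).symm⟩
  | succ k ih =>
    cases q with
    | zero => exact ⟨0, fun u hu => by
        rw [hG.toLowers.extPart_eq_zero (Nat.succ_pos k) hu, zero_smul]⟩
    | succ q =>
      obtain ⟨c, hc⟩ := ih q
      refine ⟨-c, fun u hu => ?_⟩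
      have h : ∀ i, C.extPart k (C.h i u) = c • C.h i u := fun i => hc _ (hG.succ i q u hu)
      rw [extPart, extSum_apply]
      simp only [h, map_smul, ← Finset.smul_sum, hG.sum_e_h hu, smul_neg, neg_smul]

theorem Whitney.whitneyPart_eq_zero {G : ℕ → Submodule ℝ W} (hG : C.Whitney G) (k q : ℕ) {u : W}
    (hu : u ∈ G q) : C.whitneyPart k u = 0 := by
  induction k generalizing q u with
  | zero => rfl
  | succ k ih =>
    cases q with
    | zero => exact hG.toLowers.whitneyPart_eq_zero (Nat.succ_pos k) hu
    | succ q =>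
      obtain ⟨c, hc⟩ := hG.exists_extPart k q
      have h1 : ∀ i, C.extPart k (C.h i u) = c • C.h i u := fun i => hc _ (hG.succ i q u hu)
      have h2 : ∀ i, C.whitneyPart k (C.h i u) = 0 := fun i => ih q (hG.succ i q u hu)
      rw [whitneyPart, LinearMap.sub_apply, extSum_apply, mulSum_apply]
      simp only [h1, h2, map_smul, ← Finset.smul_sum, hG.sum_m_h _ u hu, smul_zero, map_zero,
        Finset.sum_const_zero, sub_zero]

theorem Whitney.homotopyOp_eq_zero {G : ℕ → Submodule ℝ W} (hG : C.Whitney G) (M q : ℕ) {u : W}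
    (hu : u ∈ G q) : C.homotopyOp M u = 0 := by
  rw [homotopyOp, LinearMap.sum_apply]
  exact Finset.sum_eq_zero fun k _ => by
    rw [LinearMap.smul_apply, hG.whitneyPart_eq_zero _ q hu, smul_zero]

/-! ### Naturality of the averaged operators -/

variable {W' : Type*} [AddCommGroup W'] [Module ℝ W'] (C) (C' : Contractions ι (Module.End ℝ W'))

/-- A linear map compatible with the operators, except possibly for the homotopies `h i` such
that `m i` vanishes on the target. -/
structure Intertwines (p : W →ₗ[ℝ] W') : Prop where
  index : C'.index = C.index
  d : ∀ u, p (C.d u) = C'.d (p u)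
  m : ∀ i u, p (C.m i u) = C'.m i (p u)
  h : ∀ i, C'.m i = 0 ∨ ∀ u, p (C.h i u) = C'.h i (p u)

variable {C C'} {p : W →ₗ[ℝ] W'}

theorem Intertwines.e (hp : Intertwines C C' p) (i : ι) (u : W) :
    p (C.e i u) = C'.e i (p u) := by
  simp [Contractions.e, hp.d, hp.m]

/-- Where m_i vanishes on the target, so does the commutator e_i, and an incompatible h_i has no
effect. -/
theorem Intertwines.extSum (hp : Intertwines C C' p) {X : Module.End ℝ W} {X' : Module.End ℝ W'}
    (hX : ∀ u, p (X u) = X' (p u)) (u : W) : p (C.extSum X u) = C'.extSum X' (p u) := by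
  rw [extSum_apply, extSum_apply, hp.index, map_sum]
  refine Finset.sum_congr rfl fun i _ => ?_
  rw [hp.e]
  rcases hp.h i with h | h
  · simp [Contractions.e, h]
  · rw [hX, h]

theorem Intertwines.mulSum (hp : Intertwines C C' p) {X : Module.End ℝ W} {X' : Module.End ℝ W'}
    (hX : ∀ u, p (X u) = X' (p u)) (u : W) : p (C.mulSum X u) = C'.mulSum X' (p u) := by
  rw [mulSum_apply, mulSum_apply, hp.index, map_sum]
  refine Finset.sum_congr rfl fun i _ => ?_
  rw [hp.m]
  rcases hp.h i with h | h
  · simp [h]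
  · rw [hX, h]

theorem Intertwines.extPart (hp : Intertwines C C' p) (k : ℕ) (u : W) :
    p (C.extPart k u) = C'.extPart k (p u) := by
  induction k generalizing u with
  | zero => rfl
  | succ k ih => exact hp.extSum ih u

theorem Intertwines.whitneyPart (hp : Intertwines C C' p) (k : ℕ) (u : W) :
    p (C.whitneyPart k u) = C'.whitneyPart k (p u) := by
  induction k generalizing u with
  | zero => exact map_zero p
  | succ k ih =>
    rw [Contractions.whitneyPart, Contractions.whitneyPart, LinearMap.sub_apply, map_sub,
      hp.mulSum (hp.extPart k), hp.extSum ih, LinearMap.sub_apply]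

theorem Intertwines.homotopyOp (hp : Intertwines C C' p) (M : ℕ) (u : W) :
    p (C.homotopyOp M u) = C'.homotopyOp M (p u) := by
  simp only [Contractions.homotopyOp, LinearMap.sum_apply, map_sum, LinearMap.smul_apply,
    map_smul, hp.whitneyPart]

end Module

end Contractions

theorem sum_piFinset_cons {ι M : Type*} [AddCommMonoid M] (N : Finset ι) (k : ℕ)
    (f : (Fin (k + 1) → ι) → M) :
    ∑ I ∈ Fintype.piFinset fun _ : Fin (k + 1) => N, f I
      = ∑ i ∈ N, ∑ I ∈ Fintype.piFinset fun _ : Fin k => N, f (Fin.cons i I) := by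
  rw [← Finset.sum_product']
  refine Finset.sum_nbij' (fun I => (I 0, Fin.tail I)) (fun p => Fin.cons p.1 p.2) ?_ ?_ ?_ ?_ ?_
  · intro I hI
    rw [Fintype.mem_piFinset] at hI
    simp only [Finset.mem_product, Fintype.mem_piFinset]
    exact ⟨hI 0, fun j => hI j.succ⟩
  · rintro ⟨i, I⟩ hI
    simp only [Finset.mem_product, Fintype.mem_piFinset] at hI ⊢
    exact fun j => Fin.cases hI.1 hI.2 j
  · intro I _
    exact Fin.cons_self_tail I
  · intro p _
    simp
  · intro I _
    simp

/-! ### Homogeneous forms -/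

section Homogeneous

variable {E : Type u} {A : Type*} [NormedAddCommGroup E] [NormedSpace ℝ E] [AddTorsor E A]
  {B : Set A} {k : ℕ}

/-- The form of all degrees which has only a component of degree `k`. -/
def homogeneous (k : ℕ) : smoothForms E B k →ₗ[ℝ] Forms E B :=
  LinearMap.single ℝ (fun k => smoothForms E B k) k

theorem homogeneous_same (u : smoothForms E B k) : homogeneous k u k = u :=
  Pi.single_eq_same (M := fun k => smoothForms E B k) k u

theorem homogeneous_of_ne {j : ℕ} (h : j ≠ k) (u : smoothForms E B k) : homogeneous k u j = 0 :=
  Pi.single_eq_of_ne (M := fun k => smoothForms E B k) h u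

theorem eq_homogeneous {w : Forms E B} {u : smoothForms E B k} (h : w k = u)
    (h' : ∀ j, j ≠ k → w j = 0) : w = homogeneous k u := by
  funext j
  by_cases hj : j = k
  · subst hj
    rw [homogeneous_same, h]
  · rw [homogeneous_of_ne hj, h' j hj]

theorem raise_homogeneous (f : ∀ k, smoothForms E B k →ₗ[ℝ] smoothForms E B (k + 1))
    (u : smoothForms E B k) : raise f (homogeneous k u) = homogeneous (k + 1) (f k u) := by
  refine eq_homogeneous (congrArg (f k) (homogeneous_same u)) fun j hj => ?_
  cases j with
  | zero => rfl
  | succ j =>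
    exact (congrArg (f j) (homogeneous_of_ne (by omega) u)).trans (map_zero _)

theorem lower_homogeneous_zero (f : ∀ k, smoothForms E B (k + 1) →ₗ[ℝ] smoothForms E B k)
    (u : smoothForms E B 0) : lower f (homogeneous 0 u) = 0 := by
  funext j
  exact (congrArg (f j) (homogeneous_of_ne (by omega) u)).trans (map_zero _)

theorem lower_homogeneous_succ (f : ∀ k, smoothForms E B (k + 1) →ₗ[ℝ] smoothForms E B k)
    (u : smoothForms E B (k + 1)) : lower f (homogeneous (k + 1) u) = homogeneous k (f k u) := by
  refine eq_homogeneous (congrArg (f k) (homogeneous_same u)) fun j hj => ?_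
  exact (congrArg (f j) (homogeneous_of_ne (by omega) u)).trans (map_zero _)

theorem diagonal_homogeneous (f : ∀ k, smoothForms E B k →ₗ[ℝ] smoothForms E B k)
    (u : smoothForms E B k) : diagonal f (homogeneous k u) = homogeneous k (f k u) := by
  refine eq_homogeneous (congrArg (f k) (homogeneous_same u)) fun j hj => ?_
  exact (congrArg (f j) (homogeneous_of_ne hj u)).trans (map_zero _)

theorem mulOp_homogeneous [FiniteDimensional ℝ E] (l : A →ᵃ[ℝ] ℝ) (u : smoothForms E B k) :
    mulOp B l (homogeneous k u) = homogeneous k (mulForm l u) :=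
  diagonal_homogeneous _ u

theorem extDOp_homogeneous (hB : UniqueDiff (E := E) B) (u : smoothForms E B k) :
    extDOp hB (homogeneous k u) = homogeneous (k + 1) ⟨extD u.1, u.2.extD hB⟩ :=
  raise_homogeneous _ u

variable {E' : Type u} {A' : Type*} [NormedAddCommGroup E'] [NormedSpace ℝ E']
  [FiniteDimensional ℝ E'] [AddTorsor E' A'] {B' : Set A'}

theorem pullbackOp_homogeneous (g : A' →ᵃ[ℝ] A) (hg : Set.MapsTo g B' B)
    (u : smoothForms E B k) :
    pullbackOp g hg (homogeneous k u) = homogeneous k ⟨pullback g hg u.1, u.2.pullback g hg⟩ := by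
  refine eq_homogeneous (Subtype.ext ?_) fun j hj => Subtype.ext ?_
  · rw [pullbackOp_apply, homogeneous_same]
  · rw [pullbackOp_apply, homogeneous_of_ne hj]
    funext x
    ext w
    simp [pullback]

end Homogeneous

/-! ### The operators on the forms on a simplex -/

namespace AffineRealization

variable {ι : Type*} {K : PreAbstractSimplicialComplex ι} {V : K.faces → Type u}
  [∀ s, NormedAddCommGroup (V s)] [∀ s, NormedSpace ℝ (V s)] (ρ : AffineRealization K V)

/-- The smooth forms on the realization of `s`, of all degrees. -/
abbrev simplexForms (s : K.faces) : Type _ := Forms (ρ.tangent s) (ρ.body s)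

theorem starlike_basis (s : K.faces) (j : s.1) :
    Starlike (E := ρ.tangent s) (ρ.body s) (ρ.basis s j) where
  mem := subset_convexHull ℝ _ (Set.mem_range_self j)
  segment_mem x hx t ht := by
    have := (convex_convexHull ℝ (Set.range (ρ.vertex s))).add_smul_sub_mem
      (subset_convexHull ℝ _ (Set.mem_range_self j)) hx ht
    rw [add_comm] at this
    exact this

open Classical in
/-- The vertex `i` if it belongs to `s`, and an arbitrary vertex of `s` otherwise. -/
def nearVertex (i : ι) (s : K.faces) : s.1 :=
  if h : i ∈ s.1 then ⟨i, h⟩ else Classical.arbitrary _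

theorem nearVertex_of_mem {i : ι} {s : K.faces} (h : i ∈ s.1) : nearVertex i s = ⟨i, h⟩ :=
  dif_pos h

/-! ### Contraction of Whitney forms to a vertex -/

theorem integral_pow_mul_const (k : ℕ) (c : ℝ) :
    ∫ t in (0 : ℝ)..1, t ^ k * (((k + 1).factorial : ℝ) * c) = (k.factorial : ℝ) * c := by
  rw [intervalIntegral.integral_mul_const, integral_pow, Nat.factorial_succ]
  have : (k : ℝ) + 1 ≠ 0 := by positivity
  push_cast
  field_simp
  simp

-- At p + t(x - p) the first two columns are λ(p) + t dλ(x - p) and dλ(x - p). Column operations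
-- turn them into λ(p) and λ(x), which removes t. As p is a vertex, λ(p) is a column of zeros and
-- ones, along which the determinant is expanded.
open Classical in
theorem det_whitneyMatrix_cone {k : ℕ} (v : Fin (k + 2) → ι) (s : K.faces) (j : s.1)
    (x : ρ.plane s) (w : Fin k → ρ.tangent s) (t : ℝ) :
    (ρ.whitneyMatrix v s (t • (x -ᵥ ρ.basis s j) +ᵥ ρ.basis s j)
      (Fin.cons (x -ᵥ ρ.basis s j) w)).det
      = ∑ a : Fin (k + 2), if v a = j then
        (-1) ^ (a : ℕ) * (ρ.whitneyMatrix (fun b => v (a.succAbove b)) s x w).det else 0 := by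
  set p := ρ.basis s j
  let N : Matrix (Fin (k + 2)) (Fin (k + 2)) ℝ := Matrix.of fun i =>
    Fin.cons (ρ.bary (v i) s p) (Fin.cons (ρ.bary (v i) s x) fun b => ρ.dBary (v i) s (w b))
  let N' : Matrix (Fin (k + 2)) (Fin (k + 2)) ℝ := Matrix.of fun i =>
    Fin.cons (ρ.bary (v i) s p)
      (Fin.cons (ρ.dBary (v i) s (x -ᵥ p)) fun b => ρ.dBary (v i) s (w b))
  have hx : ∀ i, ρ.bary i s x = ρ.dBary i s (x -ᵥ p) + ρ.bary i s p := fun i => by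
    rw [← bary_vadd, vsub_vadd]
  have h1 : ρ.whitneyMatrix v s (t • (x -ᵥ p) +ᵥ p) (Fin.cons (x -ᵥ p) w)
      = N'.updateCol 0 fun i => N' i 0 + t • N' i 1 := by
    ext i b
    refine Fin.cases ?_ (fun b => ?_) b
    · rw [Matrix.updateCol_self]
      change ρ.bary (v i) s (t • (x -ᵥ p) +ᵥ p)
        = ρ.bary (v i) s p + t * ρ.dBary (v i) s (x -ᵥ p)
      rw [bary_vadd, map_smul, add_comm, smul_eq_mul]
    · refine Fin.cases ?_ (fun b => ?_) b
      · simp [whitneyMatrix, N']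
      · simp [whitneyMatrix, N']
  have h2 : N = N'.updateCol 1 fun i => N' i 1 + (1 : ℝ) • N' i 0 := by
    ext i b
    refine Fin.cases ?_ (fun b => ?_) b
    · simp [N, N']
    · refine Fin.cases ?_ (fun b => ?_) b
      · simp [N, N', hx]
      · rw [Matrix.updateCol_ne (by simp [Fin.ext_iff])]
        simp [N, N']
  rw [h1, Matrix.det_updateCol_add_smul_self _ (by simp),
    ← Matrix.det_updateCol_add_smul_self N' (i := 1) (j := 0) (by simp) 1, ← h2,
    Matrix.det_succ_column_zero]
  refine Finset.sum_congr rfl fun a _ => ?_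
  have h3 : N a 0 = if v a = j then 1 else 0 := ρ.bary_vertex (v a) s j
  rw [h3]
  split_ifs
  · rw [mul_one]
    rfl
  · simp

-- The determinant does not depend on t, so the radial integral is that of t^k and replaces (k+1)!
-- by k!. With this normalization, contraction to a vertex deletes the vertex, with a sign.
open Classical in
theorem coneA_whitneyAux {k : ℕ} (v : Fin (k + 2) → ι) (s : K.faces) (j : s.1)
    (x : ρ.plane s) (w : Fin k → ρ.tangent s) :
    coneA (ρ.basis s j) (ρ.whitneyAux v s) x w
      = ∑ a : Fin (k + 2), if v a = j then
        (-1) ^ (a : ℕ) * ρ.whitneyAux (fun b => v (a.succAbove b)) s x w else 0 := by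
  rw [coneA, cone_apply (ρ.isSmooth_whitneyAux v s _)]
  simp only [whitneyAux_apply, det_whitneyMatrix_cone]
  rw [integral_pow_mul_const, Finset.mul_sum]
  refine Finset.sum_congr rfl fun a _ => ?_
  split_ifs
  · ring
  · simp

/-! ### Contractions of a simplex to its vertices, and their action on Whitney forms -/

section Finite

variable [Finite K.faces]

theorem mem_vertices {i : ι} {s : K.faces} (h : i ∈ s.1) : i ∈ vertices K := by
  simp only [vertices, Set.Finite.mem_toFinset, Set.mem_iUnion]
  exact ⟨s, h⟩

/-- The contractions of the realization of `s` to its vertices, with the partition of unity given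
by the barycentric coordinates. -/
def contractions (s : K.faces) : Contractions ι (Module.End ℝ (ρ.simplexForms s)) where
  index := vertices K
  d := extDOp (ρ.uniqueDiff_body s)
  m i := mulOp (ρ.body s) (ρ.bary i s)
  h i := coneOp (ρ.starlike_basis s (nearVertex i s))
  ε i := evalOp (ρ.starlike_basis s (nearVertex i s)).mem
  d_mul_d := extDOp_mul_self _
  sum_m := by
    ext1 u
    funext k
    apply Subtype.ext
    funext x
    rw [LinearMap.sum_apply]
    have h := congrArg (fun y : smoothForms (ρ.tangent s) (ρ.body s) k => y.1 x)
      (map_sum (component (ρ.tangent s) (ρ.body s) k)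
        (fun i => mulOp (ρ.body s) (ρ.bary i s) u) (vertices K))
    refine h.trans ?_
    simp only [Submodule.coe_sum, Finset.sum_apply]
    refine (Finset.sum_smul (f := fun i => ρ.bary i s x) (x := (u k).1 x)).symm.trans ?_
    rw [ρ.sum_bary, one_smul]
    rfl
  homotopy i := extDOp_mul_coneOp _ _
  h_mul_ε i j := coneOp_mul_evalOp _ _

/-- The restriction of forms to a face. -/
def restrict {t s : K.faces} (h : t.1 ⊆ s.1) : ρ.simplexForms s →ₗ[ℝ] ρ.simplexForms t :=
  pullbackOp (ρ.face h) (ρ.face_mapsTo h)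

theorem restrict_h {t s : K.faces} (h : t.1 ⊆ s.1) {i : ι} (hi : i ∈ t.1)
    (u : ρ.simplexForms s) :
    ρ.restrict h ((ρ.contractions s).h i u) = (ρ.contractions t).h i (ρ.restrict h u) := by
  refine pullbackOp_coneOp _ _ (ρ.starlike_basis s _) (ρ.starlike_basis t _) ?_ u
  rw [face_vertex, nearVertex_of_mem hi, nearVertex_of_mem (h hi)]

/-- For a vertex of t the two contractions have corresponding centres. For any other i the centre on
t is arbitrary, but λ_i vanishes on t. -/
theorem intertwines_restrict {t s : K.faces} (h : t.1 ⊆ s.1) :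
    Contractions.Intertwines (ρ.contractions s) (ρ.contractions t) (ρ.restrict h) where
  index := rfl
  d u := pullbackOp_extDOp (ρ.uniqueDiff_body s) (ρ.uniqueDiff_body t) _ _ u
  m i u := by
    change pullbackOp _ _ (mulOp _ _ u) = mulOp _ _ (pullbackOp _ _ u)
    rw [pullbackOp_mulOp, bary_comp_face]
  h i := by
    by_cases hi : i ∈ t.1
    · exact Or.inr (ρ.restrict_h h hi)
    · left
      ext1 u
      funext k
      apply Subtype.ext
      funext x
      change ρ.bary i t x • (u k).1 x = 0
      rw [ρ.bary_eq_zero hi]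
      exact zero_smul ℝ _

/-- The Whitney form of a tuple of vertices, on the simplex `s`. -/
def whitneyOn {k : ℕ} (v : Fin (k + 1) → ι) (s : K.faces) :
    smoothForms (ρ.tangent s) (ρ.body s) k :=
  ⟨fun x => ρ.whitneyAux v s x, _, ρ.isSmooth_whitneyAux v s, fun _ => rfl⟩

/-- The Whitney forms of degree `k` on the simplex `s`. -/
def whitneySpan (s : K.faces) (k : ℕ) : Submodule ℝ (ρ.simplexForms s) :=
  Submodule.span ℝ (Set.range fun v : Fin (k + 1) → ι => homogeneous k (ρ.whitneyOn v s))

theorem m_eq_zero {i : ι} {s : K.faces} (h : i ∉ s.1) : (ρ.contractions s).m i = 0 := by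
  ext1 u
  funext k
  apply Subtype.ext
  funext x
  change ρ.bary i s x • (u k).1 x = 0
  rw [ρ.bary_eq_zero h]
  exact zero_smul ℝ _

open Classical in
theorem h_whitneyOn {k : ℕ} (v : Fin (k + 2) → ι) (s : K.faces) (i : ι) :
    (ρ.contractions s).h i (homogeneous (k + 1) (ρ.whitneyOn v s))
      = ∑ a : Fin (k + 2), if v a = nearVertex i s then
        (-1 : ℝ) ^ (a : ℕ) • homogeneous k (ρ.whitneyOn (fun b => v (a.succAbove b)) s) else 0 := by
  refine (lower_homogeneous_succ _ _).trans ?_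
  have : ∀ a : Fin (k + 2), (if v a = nearVertex i s then
        (-1 : ℝ) ^ (a : ℕ) • homogeneous k (ρ.whitneyOn (fun b => v (a.succAbove b)) s) else 0)
      = homogeneous k (if v a = nearVertex i s then
        (-1 : ℝ) ^ (a : ℕ) • ρ.whitneyOn (fun b => v (a.succAbove b)) s else 0) := by
    intro a
    split_ifs
    · rw [map_smul]
    · rw [map_zero]
  rw [Finset.sum_congr rfl fun a _ => this a, ← map_sum]
  congr 1
  apply Subtype.ext
  funext x
  ext w
  simp only [Submodule.coe_sum, Finset.sum_apply, ContinuousAlternatingMap.sum_apply]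
  change coneOn (ρ.basis s (nearVertex i s)) (ρ.whitneyOn v s).1 x w = _
  rw [coneOn_eq (ρ.starlike_basis s _) (u := (ρ.whitneyOn v s).1) (f := ρ.whitneyAux v s)
    (fun _ => rfl), coneA_whitneyAux]
  refine Finset.sum_congr rfl fun a _ => ?_
  split_ifs
  · rfl
  · rfl

-- Up to k!, the sum is ∑ (-1)^a λ_{v a} det(λ, dλ) over the tuples with v a removed: the column
-- expansion of a determinant whose first two columns both equal λ(x).
open Classical in
theorem sum_m_h_whitneyOn {k : ℕ} (v : Fin (k + 2) → ι) (s : K.faces) :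
    ∑ i ∈ vertices K, (ρ.contractions s).m i ((ρ.contractions s).h i
      (homogeneous (k + 1) (ρ.whitneyOn v s))) = 0 := by
  have hi : ∀ i, (ρ.contractions s).m i ((ρ.contractions s).h i
      (homogeneous (k + 1) (ρ.whitneyOn v s)))
      = ∑ a : Fin (k + 2), if v a = i then (-1 : ℝ) ^ (a : ℕ) • (ρ.contractions s).m (v a)
        (homogeneous k (ρ.whitneyOn (fun b => v (a.succAbove b)) s)) else 0 := by
    intro i
    by_cases h : i ∈ s.1
    · rw [h_whitneyOn, map_sum, nearVertex_of_mem h]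
      refine Finset.sum_congr rfl fun a _ => ?_
      split_ifs with h'
      · rw [map_smul, h']
      · rw [map_zero]
    · rw [m_eq_zero ρ h]
      refine (Finset.sum_eq_zero fun a _ => ?_).symm
      split_ifs with h'
      · rw [h', m_eq_zero ρ h, LinearMap.zero_apply, smul_zero]
      · rfl
  rw [Finset.sum_congr rfl fun i _ => hi i, Finset.sum_comm]
  have ha : ∀ a : Fin (k + 2), ∑ i ∈ vertices K, (if v a = i then
        (-1 : ℝ) ^ (a : ℕ) • (ρ.contractions s).m (v a)
          (homogeneous k (ρ.whitneyOn (fun b => v (a.succAbove b)) s)) else 0)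
      = homogeneous k ((-1 : ℝ) ^ (a : ℕ) • mulForm (ρ.bary (v a) s)
          (ρ.whitneyOn (fun b => v (a.succAbove b)) s)) := by
    intro a
    rw [Finset.sum_ite_eq, map_smul, ← mulOp_homogeneous]
    split_ifs with h
    · rfl
    · have h' : v a ∉ s.1 := fun h' => h (mem_vertices h')
      change 0 = _ • (ρ.contractions s).m (v a) _
      rw [m_eq_zero ρ h', LinearMap.zero_apply, smul_zero]
  rw [Finset.sum_congr rfl fun a _ => ha a, ← map_sum, ← map_zero (homogeneous k)]
  congr 1
  apply Subtype.ext
  funext x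
  ext w
  simp only [Submodule.coe_sum, Finset.sum_apply, ContinuousAlternatingMap.sum_apply]
  let N : Matrix (Fin (k + 2)) (Fin (k + 2)) ℝ := Matrix.of fun i =>
    Fin.cons (ρ.bary (v i) s x) (Fin.cons (ρ.bary (v i) s x) fun b => ρ.dBary (v i) s (w b))
  have hN : N.det = 0 := Matrix.det_zero_of_column_eq (i := 0) (j := 1) (by simp) fun i => rfl
  rw [Matrix.det_succ_column_zero] at hN
  refine Eq.trans ?_ ((congrArg (fun y => (k.factorial : ℝ) * y) hN).trans (mul_zero _))
  rw [Finset.mul_sum]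
  refine Finset.sum_congr rfl fun a _ => ?_
  change (-1 : ℝ) ^ (a : ℕ) * (ρ.bary (v a) s x *
    ρ.whitneyAux (fun b => v (a.succAbove b)) s x w) = (k.factorial : ℝ) *
    ((-1 : ℝ) ^ (a : ℕ) * ρ.bary (v a) s x *
      (ρ.whitneyMatrix (fun b => v (a.succAbove b)) s x w).det)
  rw [whitneyAux_apply]
  ring

theorem extD_whitneyOn {k : ℕ} (v : Fin (k + 1) → ι) (s : K.faces) :
    (ρ.contractions s).d (homogeneous k (ρ.whitneyOn v s))
      = ∑ i ∈ vertices K, homogeneous (k + 1) (ρ.whitneyOn (Fin.cons i v : Fin (k + 2) → ι) s) := by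
  refine (extDOp_homogeneous (ρ.uniqueDiff_body s) _).trans ?_
  rw [← map_sum]
  congr 1
  apply Subtype.ext
  have h := congrArg (fun u : ρ.compatibleForms (k + 1) => u.1 s) (ρ.d_whitneyForm v)
  simp only [val_sum] at h
  rw [Finset.sum_apply] at h
  rw [Submodule.coe_sum]
  exact h

theorem whitney_whitneySpan (s : K.faces) : (ρ.contractions s).Whitney (ρ.whitneySpan s) where
  zero i u hu := by
    induction hu using Submodule.span_induction with
    | mem u hu =>
      obtain ⟨v, rfl⟩ := hu
      exact lower_homogeneous_zero _ _
    | zero => exact map_zero _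
    | add u v _ _ hu hv => rw [map_add, hu, hv, add_zero]
    | smul c u _ hu => rw [map_smul, hu, smul_zero]
  succ i q u hu := by
    classical
    induction hu using Submodule.span_induction with
    | mem u hu =>
      obtain ⟨v, rfl⟩ := hu
      simp only [h_whitneyOn]
      refine Submodule.sum_mem _ fun a _ => ?_
      split_ifs
      · exact Submodule.smul_mem _ _ (Submodule.subset_span ⟨_, rfl⟩)
      · exact zero_mem _
    | zero => rw [map_zero]; exact zero_mem _
    | add u v _ _ hu hv => rw [map_add]; exact add_mem hu hv
    | smul c u _ hu => rw [map_smul]; exact Submodule.smul_mem _ _ hu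
  d_mem q u hu := by
    induction hu using Submodule.span_induction with
    | mem u hu =>
      obtain ⟨v, rfl⟩ := hu
      simp only [extD_whitneyOn]
      exact Submodule.sum_mem _ fun i _ => Submodule.subset_span ⟨_, rfl⟩
    | zero => rw [map_zero]; exact zero_mem _
    | add u v _ _ hu hv => rw [map_add]; exact add_mem hu hv
    | smul c u _ hu => rw [map_smul]; exact Submodule.smul_mem _ _ hu
  ε_succ i q u hu := by
    induction hu using Submodule.span_induction with
    | mem u hu =>
      obtain ⟨v, rfl⟩ := hu
      exact (diagonal_homogeneous _ _).trans (map_zero _)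
    | zero => exact map_zero _
    | add u v _ _ hu hv => rw [map_add, hu, hv, add_zero]
    | smul c u _ hu => rw [map_smul, hu, smul_zero]
  sum_m_h q u hu := by
    change ∑ i ∈ vertices K, _ = _
    induction hu using Submodule.span_induction with
    | mem u hu =>
      obtain ⟨v, rfl⟩ := hu
      cases q with
      | zero =>
        refine Finset.sum_eq_zero fun i _ => ?_
        exact (congrArg _ (lower_homogeneous_zero _ _)).trans (map_zero _)
      | succ q => exact ρ.sum_m_h_whitneyOn v s
    | zero => simp
    | add u v _ _ hu hv => simp [Finset.sum_add_distrib, hu, hv]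
    | smul c u _ hu => simp [← Finset.smul_sum, hu]

/-! ### The projection to Whitney forms -/

/-- The iterated integral of a form on `s` along a tuple of vertices. -/
def period (s : K.faces) : ∀ {k : ℕ}, (Fin (k + 1) → ι) → ρ.simplexForms s →ₗ[ℝ] ℝ
  | 0, I =>
    { toFun := fun u => (u 0).1 ⟨ρ.basis s (nearVertex (I 0) s),
        (ρ.starlike_basis s (nearVertex (I 0) s)).mem⟩ Fin.elim0
      map_add' := fun _ _ => rfl
      map_smul' := fun _ _ => rfl }
  | _ + 1, I => period s (Fin.tail I) ∘ₗ (ρ.contractions s).h (I 0)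

/-- Only contractions to vertices of t occur, and these commute with restriction. This is what makes
periods of compatible forms independent of the simplex used. -/
theorem period_restrict {t s : K.faces} (h : t.1 ⊆ s.1) {k : ℕ} (I : Fin (k + 1) → ι)
    (hI : ∀ a, I a ∈ t.1) (u : ρ.simplexForms s) :
    ρ.period t I (ρ.restrict h u) = ρ.period s I u := by
  induction k generalizing u with
  | zero =>
    have hx : ρ.face h (ρ.basis t (nearVertex (I 0) t)) = ρ.basis s (nearVertex (I 0) s) := by
      rw [face_vertex, nearVertex_of_mem (hI 0), nearVertex_of_mem (h (hI 0))]
    change (u 0).1 ⟨ρ.face h (ρ.basis t (nearVertex (I 0) t)), _⟩ (_ ∘ Fin.elim0)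
      = (u 0).1 ⟨ρ.basis s (nearVertex (I 0) s), _⟩ Fin.elim0
    congr 1
    · simp only [hx]
    · funext a
      exact a.elim0
  | succ k ih =>
    change ρ.period t (Fin.tail I) ((ρ.contractions t).h (I 0) (ρ.restrict h u))
      = ρ.period s (Fin.tail I) ((ρ.contractions s).h (I 0) u)
    rw [← restrict_h ρ h (hI 0)]
    exact ih (Fin.tail I) (fun a => hI a.succ) _

/-- The form `dλ_{I 0} ∧ ⋯ ∧ dλ_{I (k-1)}` on the simplex `s`. -/
def wedgeOn {k : ℕ} (I : Fin k → ι) (s : K.faces) : smoothForms (ρ.tangent s) (ρ.body s) k :=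
  ⟨fun _ => wedge fun a => ρ.dBary (I a) s, fun _ => wedge fun a => ρ.dBary (I a) s,
    fun _ => contDiff_const, fun _ => rfl⟩

theorem extDOp_mul_sub_homogeneous {s : K.faces} {i : ι} {k : ℕ}
    {u : smoothForms (ρ.tangent s) (ρ.body s) k}
    {u' : smoothForms (ρ.tangent s) (ρ.body s) (k + 1)}
    (h : ∀ x w, u'.1 x w = ∑ a : Fin (k + 1), (-1) ^ (a : ℕ) *
      (ρ.dBary i s (w a) * u.1 x (a.removeNth w))) :
    (ρ.contractions s).e i (homogeneous k u) = homogeneous (k + 1) u' := by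
  refine eq_homogeneous ?_ fun j hj => ?_
  · apply Subtype.ext
    funext x
    ext w
    rw [h]
    refine (extDOp_mul_sub (ρ.uniqueDiff_body s) (ρ.bary i s) (homogeneous k u) k x w).trans ?_
    rw [homogeneous_same]
    rfl
  · cases j with
    | zero => exact extDOp_mul_sub_zero (ρ.uniqueDiff_body s) _ _
    | succ j =>
      apply Subtype.ext
      funext x
      ext w
      refine (extDOp_mul_sub (ρ.uniqueDiff_body s) (ρ.bary i s) (homogeneous k u) j x w).trans ?_
      rw [homogeneous_of_ne (by omega)]
      simp

theorem e_wedgeOn {k : ℕ} (i : ι) (I : Fin k → ι) (s : K.faces) :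
    (ρ.contractions s).e i (homogeneous k (ρ.wedgeOn I s))
      = homogeneous (k + 1) (ρ.wedgeOn (Fin.cons i I : Fin (k + 1) → ι) s) := by
  refine ρ.extDOp_mul_sub_homogeneous fun x w => ?_
  simp only [wedgeOn, wedge_apply]
  rw [Matrix.det_succ_row_zero]
  refine Finset.sum_congr rfl fun a _ => ?_
  rw [mul_assoc]
  rfl

/-- Expansion of the Whitney determinant along the row of i: the entry λ_i gives λ_i dλ_I, and the
entries dλ_i give the exterior product of dλ_i with the shorter Whitney form. This explains the
minus sign in the recursion for `whitneyPart`. -/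
theorem m_wedgeOn_sub_e_whitneyOn {k : ℕ} (i : ι) (I : Fin (k + 1) → ι) (s : K.faces) :
    (ρ.contractions s).m i (homogeneous (k + 1) (ρ.wedgeOn I s))
        - (ρ.contractions s).e i ((k.factorial : ℝ)⁻¹ • homogeneous k (ρ.whitneyOn I s))
      = ((k + 1).factorial : ℝ)⁻¹ •
        homogeneous (k + 1) (ρ.whitneyOn (Fin.cons i I : Fin (k + 2) → ι) s) := by
  have h : (ρ.contractions s).e i (homogeneous k ((k.factorial : ℝ)⁻¹ • ρ.whitneyOn I s))
      = homogeneous (k + 1) (mulForm (ρ.bary i s) (ρ.wedgeOn I s) + (-((k + 1).factorial : ℝ)⁻¹) •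
        ρ.whitneyOn (Fin.cons i I : Fin (k + 2) → ι) s) := by
    refine ρ.extDOp_mul_sub_homogeneous fun x w => ?_
    change ρ.bary i s x * wedge (fun a => ρ.dBary (I a) s) w + (-((k + 1).factorial : ℝ)⁻¹) *
      ρ.whitneyAux (Fin.cons i I : Fin (k + 2) → ι) s x w = ∑ a : Fin (k + 1), (-1) ^ (a : ℕ) *
        (ρ.dBary i s (w a) * ((k.factorial : ℝ)⁻¹ * ρ.whitneyAux I s x (a.removeNth w)))
    simp only [whitneyAux_apply]
    have h1 : ((k + 1).factorial : ℝ) ≠ 0 := by positivity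
    have h2 : (k.factorial : ℝ) ≠ 0 := by positivity
    rw [neg_mul, inv_mul_cancel_left₀ h1, Matrix.det_succ_row_zero, Fin.sum_univ_succ, wedge_apply]
    have h3 : ∀ a : Fin (k + 1), (k.factorial : ℝ)⁻¹ * ((k.factorial : ℝ) *
        (ρ.whitneyMatrix I s x (a.removeNth w)).det)
        = (ρ.whitneyMatrix I s x (a.removeNth w)).det := fun a => inv_mul_cancel_left₀ h2 _
    simp only [h3]
    have h4 : ∀ a : Fin (k + 1), (ρ.whitneyMatrix (Fin.cons i I : Fin (k + 2) → ι) s x w).submatrix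
        Fin.succ a.succ.succAbove = ρ.whitneyMatrix I s x (a.removeNth w) := by
      intro a
      ext b c
      refine Fin.cases ?_ (fun c => ?_) c
      · simp [whitneyMatrix]
      · simp [whitneyMatrix, Fin.removeNth]
    simp only [h4]
    change ρ.bary i s x * (Matrix.of fun a b => ρ.dBary (I a) s (w b)).det + -((-1) ^ 0 *
      ρ.bary i s x * (Matrix.of fun a b => ρ.dBary (I a) s (w b)).det + ∑ a : Fin (k + 1),
        (-1) ^ (a + 1 : ℕ) * ρ.dBary i s (w a) * (ρ.whitneyMatrix I s x (a.removeNth w)).det) = _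
    rw [pow_zero, one_mul, neg_add, add_neg_cancel_left, ← Finset.sum_neg_distrib]
    refine Finset.sum_congr rfl fun a _ => ?_
    ring
  rw [← map_smul, h, map_add, map_smul, neg_smul]
  refine (congrArg (· - _) (mulOp_homogeneous _ _)).trans ?_
  abel

theorem m_homogeneous_wedgeOn_elim0 (i : ι) (I : Fin 0 → ι) (s : K.faces) :
    (ρ.contractions s).m i (homogeneous 0 (ρ.wedgeOn I s))
      = homogeneous 0 (ρ.whitneyOn (Fin.cons i I : Fin 1 → ι) s) := by
  refine (mulOp_homogeneous _ _).trans (congrArg _ (Subtype.ext <| funext fun x => ?_))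
  ext w
  change ρ.bary i s x * wedge _ w = ρ.whitneyAux _ s x w
  rw [whitneyAux_apply, wedge_apply]
  simp [whitneyMatrix]

theorem ε_apply (i : ι) (I : Fin 0 → ι) (s : K.faces) (u : ρ.simplexForms s) :
    (ρ.contractions s).ε i u
      = ρ.period s (Fin.cons i I : Fin 1 → ι) u • homogeneous 0 (ρ.wedgeOn I s) := by
  rw [← map_smul]
  refine eq_homogeneous (Subtype.ext <| funext fun x => ?_) fun j hj => ?_
  · ext w
    change (u 0).1 _ w = (u 0).1 _ Fin.elim0 * wedge _ w
    rw [wedge_apply, Matrix.det_fin_zero, mul_one, Subsingleton.elim w Fin.elim0]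
    rfl
  · obtain ⟨j, rfl⟩ := Nat.exists_eq_succ_of_ne_zero hj
    rfl

theorem extEval_apply (s : K.faces) (k : ℕ) (u : ρ.simplexForms s) :
    (ρ.contractions s).extEval k u
      = (-1 : ℝ) ^ k • ∑ I ∈ Fintype.piFinset fun _ : Fin (k + 1) => vertices K,
          ρ.period s I u • homogeneous (k + 1) (ρ.wedgeOn I s) := by
  induction k generalizing u with
  | zero =>
    rw [sum_piFinset_cons, Contractions.extEval, LinearMap.sum_apply, pow_zero, one_smul]
    refine Finset.sum_congr rfl fun i _ => ?_
    rw [Fintype.piFinset_of_isEmpty, Fintype.sum_unique, Module.End.mul_apply,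
      ρ.ε_apply i default, map_smul, e_wedgeOn]
  | succ k ih =>
    rw [sum_piFinset_cons, Contractions.extEval, LinearMap.neg_apply, Contractions.extSum_apply,
      pow_succ, mul_neg_one, neg_smul, Finset.smul_sum]
    congr 1
    refine Finset.sum_congr rfl fun i _ => ?_
    rw [ih, map_smul, map_sum]
    congr 1
    refine Finset.sum_congr rfl fun I _ => ?_
    rw [map_smul, e_wedgeOn]
    rfl

/-- This is why the projection lands in Whitney forms. In the recursion the outer h_i is absorbed
into the period, while m_i and e_i assemble the Whitney form of the lengthened tuple. -/
theorem whitneyEval_apply (s : K.faces) (k : ℕ) (u : ρ.simplexForms s) :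
    (ρ.contractions s).whitneyEval k u
      = -((-1 : ℝ) ^ k • ∑ I ∈ Fintype.piFinset fun _ : Fin (k + 1) => vertices K,
          ρ.period s I u • (k.factorial : ℝ)⁻¹ • homogeneous k (ρ.whitneyOn I s)) := by
  induction k generalizing u with
  | zero =>
    rw [sum_piFinset_cons, Contractions.whitneyEval, LinearMap.neg_apply, LinearMap.sum_apply,
      pow_zero, one_smul]
    congr 1
    refine Finset.sum_congr rfl fun i _ => ?_
    rw [Fintype.piFinset_of_isEmpty, Fintype.sum_unique, Module.End.mul_apply,
      ρ.ε_apply i default, map_smul, m_homogeneous_wedgeOn_elim0]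
    simp
  | succ k ih =>
    rw [sum_piFinset_cons, Contractions.whitneyEval, LinearMap.add_apply,
      Contractions.extSum_apply, Contractions.mulSum_apply, ← Finset.sum_add_distrib,
      pow_succ, mul_neg_one, neg_smul, neg_neg, Finset.smul_sum]
    refine Finset.sum_congr rfl fun i _ => ?_
    rw [ih, extEval_apply, map_smul, map_neg, map_smul, ← smul_neg, ← smul_add, map_sum, map_sum,
      ← Finset.sum_neg_distrib, ← Finset.sum_add_distrib]
    congr 1
    refine Finset.sum_congr rfl fun I _ => ?_
    rw [← m_wedgeOn_sub_e_whitneyOn, smul_sub, map_smul, map_smul, sub_eq_add_neg]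
    rfl

end Finite

end AffineRealization

namespace AffineRealization

variable {ι : Type*} {K : PreAbstractSimplicialComplex ι} {V : K.faces → Type u}
  [∀ s, NormedAddCommGroup (V s)] [∀ s, NormedSpace ℝ (V s)] (ρ : AffineRealization K V)

/-! ### The homotopy operator and the projection on compatible forms -/

/-- The component of a compatible form on a simplex. -/
def onSimplex (s : K.faces) (q : ℕ) :
    ρ.compatibleForms q →ₗ[ℝ] smoothForms (ρ.tangent s) (ρ.body s) q where
  toFun u := ⟨u.1 s, u.2.1 s⟩
  map_add' _ _ := rfl
  map_smul' _ _ := rfl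

/-- The component of a compatible form on a simplex, among forms of all degrees. -/
def toSimplex (s : K.faces) (q : ℕ) : ρ.compatibleForms q →ₗ[ℝ] ρ.simplexForms s :=
  homogeneous q ∘ₗ ρ.onSimplex s q

theorem toSimplex_same (s : K.faces) (q : ℕ) (u : ρ.compatibleForms q) :
    ρ.toSimplex s q u q = ρ.onSimplex s q u :=
  homogeneous_same _

theorem toSimplex_mem_range (s : K.faces) (q : ℕ) (u : ρ.compatibleForms q) :
    ρ.toSimplex s q u ∈ LinearMap.range (homogeneous (E := ρ.tangent s) (B := ρ.body s) q) :=
  ⟨_, rfl⟩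

theorem d_d (q : ℕ) (u : ρ.compatibleForms q) : ρ.d (q + 1) (ρ.d q u) = 0 :=
  LinearMap.congr_fun (ρ.d_comp_d q) u

theorem compatibleForms_ext {q : ℕ} {u v : ρ.compatibleForms q} (h : ∀ s, u.1 s = v.1 s) : u = v :=
  Subtype.ext (funext h)

theorem restrict_toSimplex {t s : K.faces} (h : t.1 ⊆ s.1) (q : ℕ) (u : ρ.compatibleForms q) :
    ρ.restrict h (ρ.toSimplex s q u) = ρ.toSimplex t q u := by
  refine (pullbackOp_homogeneous _ _ _).trans (congrArg _ (Subtype.ext ?_))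
  exact u.2.2 t s h

theorem compatibleComplex_d (k : ℕ) :
    ρ.compatibleComplex.d k (k + 1) = ModuleCat.ofHom (ρ.d k) := by
  simp only [compatibleComplex, CochainComplex.of_d]

section Finite

variable [Finite K.faces]

theorem d_toSimplex (s : K.faces) (q : ℕ) (u : ρ.compatibleForms q) :
    (ρ.contractions s).d (ρ.toSimplex s q u) = ρ.toSimplex s (q + 1) (ρ.d q u) :=
  extDOp_homogeneous (ρ.uniqueDiff_body s) _

theorem lowers_homogeneous (s : K.faces) :
    (ρ.contractions s).Lowers fun q =>
      LinearMap.range (homogeneous (E := ρ.tangent s) (B := ρ.body s) q) where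
  zero i u hu := by
    obtain ⟨u, rfl⟩ := hu
    exact lower_homogeneous_zero _ _
  succ i q u hu := by
    obtain ⟨u, rfl⟩ := hu
    exact ⟨_, (lower_homogeneous_succ _ _).symm⟩

/-- The homotopy operator on compatible forms. -/
def homotopyMap (q : ℕ) : ρ.compatibleForms (q + 1) →ₗ[ℝ] ρ.compatibleForms q where
  -- In degree q + 1 all truncations from q + 1 on agree; q + 2 is the one used in
  -- `d_mul_homotopyOp_toSimplex`.
  toFun u := ⟨fun s => ((ρ.contractions s).homotopyOp (q + 2) (ρ.toSimplex s (q + 1) u) q).1,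
    fun s => ((ρ.contractions s).homotopyOp (q + 2) (ρ.toSimplex s (q + 1) u) q).2,
    fun t s h => by
      have e := (ρ.intertwines_restrict h).homotopyOp (q + 2) (ρ.toSimplex s (q + 1) u)
      rw [ρ.restrict_toSimplex h] at e
      exact congrArg (fun w : ρ.simplexForms t => (w q).1) e⟩
  map_add' u v := ρ.compatibleForms_ext fun s => by
    simp only [map_add]
    rfl
  map_smul' c u := ρ.compatibleForms_ext fun s => by
    simp only [map_smul]
    rfl

open Classical in
/-- The iterated integral of a compatible form along a tuple of vertices, which is `0` unless they
belong to a simplex. -/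
def integralOn {q : ℕ} (I : Fin (q + 1) → ι) : ρ.compatibleForms q →ₗ[ℝ] ℝ :=
  if h : Finset.univ.image I ∈ K.faces then ρ.period ⟨_, h⟩ I ∘ₗ ρ.toSimplex ⟨_, h⟩ q else 0

/-- The simplex spanned by I is a face of s, and by compatibility u restricts to it. -/
theorem integralOn_eq {q : ℕ} {I : Fin (q + 1) → ι} {s : K.faces} (hI : ∀ a, I a ∈ s.1)
    (u : ρ.compatibleForms q) : ρ.integralOn I u = ρ.period s I (ρ.toSimplex s q u) := by
  classical
  have hsub : Finset.univ.image I ⊆ s.1 := by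
    intro i hi
    obtain ⟨a, -, rfl⟩ := Finset.mem_image.1 hi
    exact hI a
  have h : Finset.univ.image I ∈ K.faces :=
    (K.isRelLowerSet_faces s.2).2 hsub (Finset.univ_nonempty.image I)
  have h' : ρ.integralOn I = ρ.period ⟨_, h⟩ I ∘ₗ ρ.toSimplex ⟨_, h⟩ q := by
    rw [integralOn]
    convert dif_pos h
  rw [h', LinearMap.comp_apply,
    ← ρ.restrict_toSimplex (t := ⟨Finset.univ.image I, h⟩) (s := s) hsub]
  exact ρ.period_restrict _ I (fun a => Finset.mem_image_of_mem I (Finset.mem_univ a)) _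

/-- The projection of compatible forms to lowest order finite elements. -/
def whitneyProjection (σ : Orientation K) (q : ℕ) :
    ρ.compatibleForms q →ₗ[ℝ] ρ.whitneyForms σ q :=
  ((q : ℝ) + 1)⁻¹ • ∑ I ∈ Fintype.piFinset fun _ : Fin (q + 1) => vertices K,
    (ρ.integralOn I).smulRight
      ((q.factorial : ℝ)⁻¹ • (⟨ρ.whitneyForm I, ρ.whitneyForm_mem σ I⟩ : ρ.whitneyForms σ q))

theorem whitneyProjection_apply (σ : Orientation K) (q : ℕ) (u : ρ.compatibleForms q) :
    (ρ.whitneyProjection σ q u).1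
      = ((q : ℝ) + 1)⁻¹ • ∑ I ∈ Fintype.piFinset fun _ : Fin (q + 1) => vertices K,
          ρ.integralOn I u • (q.factorial : ℝ)⁻¹ • ρ.whitneyForm I := by
  rw [whitneyProjection, LinearMap.smul_apply, LinearMap.sum_apply, Submodule.coe_smul,
    Submodule.coe_sum]
  rfl

/-- W_k takes values in degree k, so only k = q contributes in degree q, and the two signs (-1)^q
cancel. The period on s may differ from the global integral when I has a vertex outside s, but then
the Whitney form of I vanishes on s. -/
theorem projectionOp_toSimplex (σ : Orientation K) (s : K.faces) (q : ℕ)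
    (u : ρ.compatibleForms q) :
    (ρ.contractions s).projectionOp (q + 2) (ρ.toSimplex s q u) q
      = ρ.toSimplex s q (ρ.whitneyProjection σ q u).1 q := by
  obtain ⟨X, hX⟩ : ∃ X, component (ρ.tangent s) (ρ.body s) q
      ((ρ.contractions s).whitneyEval q (ρ.toSimplex s q u)) = X := ⟨_, rfl⟩
  have hk : ∀ k, component (ρ.tangent s) (ρ.body s) q
      ((ρ.contractions s).whitneyEval k (ρ.toSimplex s q u))
      = if k = q then X else 0 := by
    intro k
    split_ifs with h
    · rw [h, hX]
    · rw [whitneyEval_apply, map_neg, map_smul, map_sum, neg_eq_zero]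
      refine smul_eq_zero_of_right _ (Finset.sum_eq_zero fun I _ => ?_)
      rw [map_smul, map_smul]
      refine smul_eq_zero_of_right _ (smul_eq_zero_of_right _ ?_)
      exact homogeneous_of_ne (Ne.symm h) _
  have h1 : component (ρ.tangent s) (ρ.body s) q
      ((ρ.contractions s).projectionOp (q + 2) (ρ.toSimplex s q u))
      = ((q : ℝ) + 1)⁻¹ • ∑ I ∈ Fintype.piFinset fun _ : Fin (q + 1) => vertices K,
          ρ.period s I (ρ.toSimplex s q u) • (q.factorial : ℝ)⁻¹ • ρ.whitneyOn I s := by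
    rw [Contractions.projectionOp, LinearMap.neg_apply, LinearMap.sum_apply, map_neg, map_sum]
    simp only [LinearMap.smul_apply, map_smul, hk, smul_ite, smul_zero]
    rw [Finset.sum_ite_eq', if_pos (Finset.mem_range.2 (by omega)), ← hX, whitneyEval_apply,
      map_neg, map_smul, map_sum, smul_neg]
    refine (neg_neg (_ : smoothForms (ρ.tangent s) (ρ.body s) q)).trans ?_
    rw [smul_smul, div_mul_eq_mul_div, ← mul_pow]
    have h2 : ((-1 : ℝ) * -1) ^ q / (q + 1) = ((q : ℝ) + 1)⁻¹ := by norm_num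
    rw [h2]
    congr 1
    refine Finset.sum_congr rfl fun I _ => ?_
    rw [map_smul, map_smul]
    congr 2
    exact homogeneous_same _
  refine h1.trans (Eq.trans ?_ (ρ.toSimplex_same s q _).symm)
  have h3 : ∀ I : Fin (q + 1) → ι, ρ.period s I (ρ.toSimplex s q u) • ρ.whitneyOn I s
      = ρ.integralOn I u • ρ.whitneyOn I s := by
    intro I
    by_cases hI : ∀ a, I a ∈ s.1
    · rw [ρ.integralOn_eq hI]
    · push Not at hI
      obtain ⟨a, ha⟩ := hI
      have : ρ.whitneyOn I s = 0 := by
        apply Subtype.ext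
        funext x
        ext w
        change ρ.whitneyAux I s x w = 0
        rw [whitneyAux_apply, Matrix.det_eq_zero_of_row_eq_zero a, mul_zero]
        intro j
        simp only [whitneyMatrix, Matrix.of_apply, ρ.bary_eq_zero ha, ρ.dBary_eq_zero ha]
        exact Fin.cases rfl (fun _ => rfl) j
      rw [this, smul_zero, smul_zero]
  rw [whitneyProjection_apply, map_smul, map_sum]
  congr 1
  refine Finset.sum_congr rfl fun I _ => ?_
  rw [smul_comm, h3, smul_comm, map_smul, map_smul]
  rfl

theorem d_mul_homotopyOp_toSimplex (σ : Orientation K) (s : K.faces) (q : ℕ)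
    (u : ρ.compatibleForms q) :
    (ρ.contractions s).d ((ρ.contractions s).homotopyOp (q + 2) (ρ.toSimplex s q u)) q
        + (ρ.contractions s).homotopyOp (q + 2) (ρ.toSimplex s (q + 1) (ρ.d q u)) q
      = ρ.onSimplex s q (u - (ρ.whitneyProjection σ q u).1) := by
  have e := LinearMap.congr_fun ((ρ.contractions s).d_mul_homotopyOp (q + 2)) (ρ.toSimplex s q u)
  have h : (ρ.contractions s).extPart (q + 2) (ρ.toSimplex s q u) = 0 :=
    (ρ.lowers_homogeneous s).extPart_eq_zero (by omega) (ρ.toSimplex_mem_range s q u)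
  simp only [LinearMap.add_apply, LinearMap.sub_apply, Module.End.mul_apply, LinearMap.smul_apply,
    Module.End.one_apply, h, smul_zero, sub_zero, d_toSimplex] at e
  refine (congrArg (fun w : ρ.simplexForms s => w q) e).trans ?_
  change ρ.toSimplex s q u q - (ρ.contractions s).projectionOp (q + 2) (ρ.toSimplex s q u) q = _
  rw [ρ.projectionOp_toSimplex σ, toSimplex_same, toSimplex_same, map_sub]

theorem d_homotopyMap_add (σ : Orientation K) (q : ℕ) (u : ρ.compatibleForms (q + 1)) :
    ρ.d q (ρ.homotopyMap q u) + ρ.homotopyMap (q + 1) (ρ.d (q + 1) u)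
      = u - (ρ.whitneyProjection σ (q + 1) u).1 := by
  refine ρ.compatibleForms_ext fun s => ?_
  have e := ρ.d_mul_homotopyOp_toSimplex σ s (q + 1) u
  -- The identity in degree q + 1 is truncated at q + 3, whereas `homotopyMap q` stops at q + 2; the
  -- extra term vanishes on u.
  rw [(ρ.lowers_homogeneous s).homotopyOp_succ (by omega) (ρ.toSimplex_mem_range s (q + 1) u)] at e
  exact congrArg Subtype.val e

theorem homotopyMap_d_zero (σ : Orientation K) (u : ρ.compatibleForms 0) :
    ρ.homotopyMap 0 (ρ.d 0 u) = u - (ρ.whitneyProjection σ 0 u).1 := by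
  refine ρ.compatibleForms_ext fun s => ?_
  have e := ρ.d_mul_homotopyOp_toSimplex σ s 0 u
  exact congrArg Subtype.val ((zero_add _).symm.trans e)

theorem homotopyMap_whitneyForms (σ : Orientation K) (q : ℕ) {u : ρ.compatibleForms (q + 1)}
    (hu : u ∈ ρ.whitneyForms σ (q + 1)) : ρ.homotopyMap q u = 0 := by
  refine ρ.compatibleForms_ext fun s => ?_
  have h : ρ.toSimplex s (q + 1) u ∈ ρ.whitneySpan s (q + 1) := by
    induction hu using Submodule.span_induction with
    | mem u hu =>
      obtain ⟨T, rfl⟩ := hu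
      exact Submodule.subset_span ⟨_, rfl⟩
    | zero => rw [map_zero]; exact zero_mem _
    | add u v _ _ hu hv => rw [map_add]; exact add_mem hu hv
    | smul c u _ hu => rw [map_smul]; exact Submodule.smul_mem _ _ hu
  exact congrArg (fun w : ρ.simplexForms s => (w q).1)
    ((ρ.whitney_whitneySpan s).homotopyOp_eq_zero (q + 2) (q + 1) h)

/-- Both u and du lie in Λ, where H vanishes, so the homotopy identity reads 0 = u - Pu. -/
theorem whitneyProjection_eq_self (σ : Orientation K) (q : ℕ) (u : ρ.whitneyForms σ q) :
    ρ.whitneyProjection σ q u.1 = u := by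
  have hd := ρ.homotopyMap_whitneyForms σ q (ρ.d_mem_whitneyForms σ u.2)
  apply Subtype.ext
  symm
  rw [← sub_eq_zero]
  cases q with
  | zero => rw [← ρ.homotopyMap_d_zero σ, hd]
  | succ q =>
    rw [← ρ.d_homotopyMap_add σ, hd, ρ.homotopyMap_whitneyForms σ q u.2, map_zero, add_zero]

/-- The homotopy identity, used at du and at u, gives du - P du = dH du = d(u - Pu). -/
theorem whitneyProjection_d (σ : Orientation K) (q : ℕ) (u : ρ.compatibleForms q) :
    (ρ.whitneyProjection σ (q + 1) (ρ.d q u)).1 = ρ.d q (ρ.whitneyProjection σ q u).1 := by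
  have h1 := ρ.d_homotopyMap_add σ q (ρ.d q u)
  rw [d_d, map_zero, add_zero] at h1
  have h2 : ρ.d q (ρ.homotopyMap q (ρ.d q u)) = ρ.d q (u - (ρ.whitneyProjection σ q u).1) := by
    cases q with
    | zero => rw [ρ.homotopyMap_d_zero σ]
    | succ q => rw [← ρ.d_homotopyMap_add σ, map_add, d_d, zero_add]
  rw [h2, map_sub] at h1
  exact (sub_right_injective h1).symm

/-! ### The homotopy equivalence -/

open CategoryTheory

/-- The projection of compatible forms to finite elements, as a map of complexes. -/
def whitneyRetraction (σ : Orientation K) : ρ.compatibleComplex ⟶ ρ.whitneyComplex σ :=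
  CochainComplex.ofHom (fun k => ModuleCat.ofHom (ρ.whitneyProjection σ k)) (fun k => by
    simp only [whitneyComplex, compatibleComplex, CochainComplex.of_d]
    exact ModuleCat.hom_ext <| LinearMap.ext fun u =>
      Subtype.ext (ρ.whitneyProjection_d σ k u).symm)

theorem whitneyInclusion_retraction (σ : Orientation K) :
    ρ.whitneyInclusion σ ≫ ρ.whitneyRetraction σ = 𝟙 _ :=
  HomologicalComplex.hom_ext _ _ fun k => ModuleCat.hom_ext <| LinearMap.ext fun u =>
    ρ.whitneyProjection_eq_self σ k u

/-- The components of the homotopy from the identity to the projection to finite elements. -/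
def homotopyHom (i j : ℕ) : ρ.compatibleComplex.X i ⟶ ρ.compatibleComplex.X j :=
  if h : i = j + 1 then
    eqToHom (congrArg ρ.compatibleComplex.X h) ≫ ModuleCat.ofHom (ρ.homotopyMap j)
  else 0

theorem homotopyHom_succ (j : ℕ) :
    ρ.homotopyHom (j + 1) j = ModuleCat.ofHom (ρ.homotopyMap j) := by
  rw [homotopyHom, dif_pos rfl]
  exact Category.id_comp _

/-- The homotopy from the identity to the projection to finite elements. -/
def whitneyHomotopy (σ : Orientation K) :
    Homotopy (𝟙 ρ.compatibleComplex) (ρ.whitneyRetraction σ ≫ ρ.whitneyInclusion σ) where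
  hom := ρ.homotopyHom
  zero i j h := dif_neg fun h' => h h'.symm
  comm i := by
    rw [dNext_eq _ (show (ComplexShape.up ℕ).Rel i (i + 1) from rfl), homotopyHom_succ,
      compatibleComplex_d]
    cases i with
    | zero =>
      rw [prevD_nat]
      refine ModuleCat.hom_ext <| LinearMap.ext fun u => ?_
      have e := ρ.homotopyMap_d_zero σ u
      -- Natural subtraction makes 0 - 1 equal to 0, and the complex has no differential from degree
      -- 0 to itself.
      have hd : ρ.compatibleComplex.d (0 - 1) 0 = 0 := ρ.compatibleComplex.shape _ _ (by simp)
      rw [hd, Limits.comp_zero, add_zero]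
      exact eq_add_of_sub_eq e.symm
    | succ i =>
      rw [prevD_eq _ (show (ComplexShape.up ℕ).Rel i (i + 1) from rfl), homotopyHom_succ,
        compatibleComplex_d]
      refine ModuleCat.hom_ext <| LinearMap.ext fun u => ?_
      have e := ρ.d_homotopyMap_add σ i u
      rw [add_comm (ρ.d i (ρ.homotopyMap i u))] at e
      exact eq_add_of_sub_eq e.symm

end Finite

end AffineRealization
end PiecewiseForms
end

theorem theorem3p1 {ι : Type*} (K : PreAbstractSimplicialComplex ι) [Finite K.faces]
    {V : K.faces → Type*} [∀ s, NormedAddCommGroup (V s)] [∀ s, NormedSpace ℝ (V s)]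
    (ρ : PiecewiseForms.AffineRealization K V) (σ : PiecewiseForms.Orientation K) (k : ℕ) :
    CategoryTheory.IsIso (HomologicalComplex.homologyMap (ρ.whitneyInclusion σ) k) := by
  -- The retraction is a strict left inverse of the inclusion, and a right inverse up to
  -- `whitneyHomotopy`.
  refine ⟨HomologicalComplex.homologyMap (ρ.whitneyRetraction σ) k, ?_, ?_⟩
  · rw [← HomologicalComplex.homologyMap_comp, ρ.whitneyInclusion_retraction,
      HomologicalComplex.homologyMap_id]
  · rw [← HomologicalComplex.homologyMap_comp, ← (ρ.whitneyHomotopy σ).homologyMap_eq,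
      HomologicalComplex.homologyMap_id]
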